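/- Let $M$ be a real $n_1\times n_2$ matrix of rank $r$, where $n_1\le n_2$, with singular value decomposition $M=U\Sigma V^*$, where $\Sigma$ is an $r\times r$ diagonal matrix with positive diagonal entries, and $U$ ($n_1\times r$) and $V$ ($n_2\times r$) have orthonormal columns. For a subspace $W\subseteq\mathbb{R}^n$ of dimension $d$ with orthogonal projection $P_W$, its coherence is $\mu(W)=\frac{n}{d}\max_{1\le i\le n}\|P_W e_i\|^2$, where $(e_i)$ is the standard basis. The nuclear norm $\|X\|_*$ of a matrix $X$ is the sum of its singular values. Let $\mu_0,\mu_1>0$ and assume: - (A0) the row space and the column space of $M$ both have coherence at most $\mu_0$; - (A1) every entry of $UV^*$ has absolute value at most $\mu_1\sqrt{r/(n_1n_2)}$. Let $\Omega$ be a random set of $m$ positions, uniformly distributed over all subsets of $\{1,\dots,n_1\}\times\{1,\dots,n_2\}$ with exactly $m$ elements (in particular $m\le n_1n_2$). If, for some $\beta>1$, $$m\ \ge\ 32\,\max\{\mu_1^2,\mu_0\}\,r\,(n_1+n_2)\,\beta\,\log^2(2n_2),$$ then, with probability at least $$1-6\log(n_2)\,(n_1+n_2)^{2-2\beta}-n_2^{2-2\beta^{1/2}},$$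 the problem of minimizing $\|X\|_*$ over all real $n_1\times n_2$ matrices $X$ with $X_{ij}=M_{ij}$ for all $(i,j)\in\Omega$ has exactly one minimizer, and this minimizer is $M$. -/

import Mathlib

open Matrix MeasureTheory

noncomputable section

/-- The coherence of a subspace `U` of `ℝⁿ` with respect to the standard basis:
`(n / dim U) * max_i ‖P_U e_i‖²`. -/
def coherence {n : ℕ} (U : Submodule ℝ (EuclideanSpace ℝ (Fin n))) : ℝ :=
  ((n : ℝ) / (Module.finrank ℝ U : ℝ)) *
    ⨆ i : Fin n, ‖U.starProjection (EuclideanSpace.single i (1 : ℝ))‖ ^ 2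

/-- The column space of a real matrix, as a subspace of Euclidean space. -/
def colSpace {n₁ n₂ : ℕ} (M : Matrix (Fin n₁) (Fin n₂) ℝ) :
    Submodule ℝ (EuclideanSpace ℝ (Fin n₁)) :=
  LinearMap.range (Matrix.toEuclideanLin M)

/-- The row space of a real matrix, as a subspace of Euclidean space. -/
def rowSpace {n₁ n₂ : ℕ} (M : Matrix (Fin n₁) (Fin n₂) ℝ) :
    Submodule ℝ (EuclideanSpace ℝ (Fin n₂)) :=
  colSpace Mᵀ

/-- The nuclear norm: the sum of the `min n₁ n₂` largest singular values (with multiplicity). -/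
def nuclearNorm {n₁ n₂ : ℕ} (X : Matrix (Fin n₁) (Fin n₂) ℝ) : ℝ :=
  ∑ k ∈ Finset.range (min n₁ n₂), (Matrix.toEuclideanLin X).singularValues k

/-- `M = U Σ Vᵀ` is a (thin) singular value decomposition, where `Σ = diag σ` is `r × r` with
positive diagonal entries and `U`, `V` have orthonormal columns. -/
structure IsThinSVD {n₁ n₂ r : ℕ} (M : Matrix (Fin n₁) (Fin n₂) ℝ)
    (U : Matrix (Fin n₁) (Fin r) ℝ) (σ : Fin r → ℝ) (V : Matrix (Fin n₂) (Fin r) ℝ) : Prop where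
  orthonormal_left : Uᵀ * U = 1
  orthonormal_right : Vᵀ * V = 1
  pos : ∀ k, 0 < σ k
  eq : M = U * Matrix.diagonal σ * Vᵀ

/-- The matrices that agree with `M` on the set `Ω` of observed positions. -/
def feasibleSet {n₁ n₂ : ℕ} (M : Matrix (Fin n₁) (Fin n₂) ℝ) (Ω : Finset (Fin n₁ × Fin n₂)) :
    Set (Matrix (Fin n₁) (Fin n₂) ℝ) :=
  {X | ∀ p ∈ Ω, X p.1 p.2 = M p.1 p.2}

/-- `X` solves: minimize `‖X‖_*` subject to `X i j = M i j` for `(i, j) ∈ Ω`. -/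
def IsNuclearNormMinimizer {n₁ n₂ : ℕ} (M : Matrix (Fin n₁) (Fin n₂) ℝ)
    (Ω : Finset (Fin n₁ × Fin n₂)) (X : Matrix (Fin n₁) (Fin n₂) ℝ) : Prop :=
  X ∈ feasibleSet M Ω ∧ IsMinOn nuclearNorm (feasibleSet M Ω) X

/-- The random set `Ω` is uniformly distributed over the subsets of `ι` with exactly `m`
elements (sampling without replacement). -/
structure IsUniformSample {S : Type*} [MeasurableSpace S] (P : Measure S)
    {ι : Type*} [Fintype ι] (Ω : S → Finset ι) (m : ℕ) : Prop where
  measurable : ∀ A : Finset ι, MeasurableSet {s | Ω s = A}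
  card_eq : ∀ᵐ s ∂P, (Ω s).card = m
  prob_eq : ∀ A : Finset ι, A.card = m → P.real {s | Ω s = A} = 1 / ((Fintype.card ι).choose m : ℝ)

end

/-! Let `T` be the space of matrices `U A + B Vᵀ`, with orthogonal projection `tanProj (U * Uᵀ) (V *
Vᵀ)`. Take a competitor `X = M + H`, where `H` vanishes on the samples, and let `G` be the component
of `H` orthogonal to `T`. If `Q` is the partial isometry of `G`, then `U Vᵀ + Q` has spectral norm
at most one, so by duality `‖X‖_* ≥ ‖M‖_* + ⟨U Vᵀ, H⟩ + ‖G‖_*`. A matrix `Y` supported on the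
samples is orthogonal to `H`. If its `T`-part is close to `U Vᵀ` and its remaining part has spectral
norm at most `9/10`, then `⟨U Vᵀ, H⟩ > -‖G‖_*`, provided that the `T`-part of `H` is controlled by
`G`. This control holds when sampling is bounded below on `T` and no position is repeated too often.
The deterministic argument is `IsThinSVD.nuclearNorm_lt_of_dualCertificate`.

The certificate comes from the golfing scheme (`freq_not_exists_dualCertificate_le`). Each
independent batch of samples approximates the current residual, which starts at `U Vᵀ`. The new
residual has half the entrywise bound, and the error outside `T` is proportional to the old bound,
so the errors form a geometric series. One batch is controlled by scalar and matrix Bernstein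
inequalities (`freq_exists_quadraticForm_gt_le`), which rest on the Ahlswede–Winter trace argument
and the Golden–Thompson inequality (`trace_exp_add_le`).

Batches are drawn with replacement. Since success persists when positions are added, a uniform
`m`-set succeeds at least as often as `p * q ≤ m` draws with replacement
(`IsUniformSample.one_sub_freq_le`). About `3/4 log(2 n₂)` batches make the final residual
negligible. -/

noncomputable section

/-! ### The Lie–Trotter product formula. -/

section Trotter

open Filter Topology

variable {𝔸 : Type*} [NormedRing 𝔸]

/-- Telescoping. The power `K ^ n` is harmless because it is used with `K = exp (c / n)`. -/
theorem norm_pow_sub_pow_le_mul [NormOneClass 𝔸] {x y : 𝔸} {K : ℝ} (hK : 1 ≤ K) (hx : ‖x‖ ≤ K)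
    (hy : ‖y‖ ≤ K) (n : ℕ) : ‖x ^ n - y ^ n‖ ≤ n * K ^ n * ‖x - y‖ := by
  induction n with
  | zero => simp
  | succ n ih =>
    have hK0 : 0 ≤ K := zero_le_one.trans hK
    have e : x ^ (n + 1) - y ^ (n + 1) = x * (x ^ n - y ^ n) + (x - y) * y ^ n := by
      rw [pow_succ', pow_succ']; noncomm_ring
    have h1 : ‖x * (x ^ n - y ^ n)‖ ≤ K * (n * K ^ n * ‖x - y‖) :=
      (norm_mul_le _ _).trans (mul_le_mul hx ih (norm_nonneg _) hK0)
    have h2 : ‖(x - y) * y ^ n‖ ≤ ‖x - y‖ * K ^ n :=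
      (norm_mul_le _ _).trans (mul_le_mul_of_nonneg_left
        ((norm_pow_le _ _).trans (pow_le_pow_left₀ (norm_nonneg _) hy _)) (norm_nonneg _))
    have h3 : ‖x - y‖ * K ^ n ≤ ‖x - y‖ * K ^ (n + 1) :=
      mul_le_mul_of_nonneg_left (pow_le_pow_right₀ hK n.le_succ) (norm_nonneg _)
    rw [e]
    refine (norm_add_le _ _).trans ((add_le_add h1 (h2.trans h3)).trans (le_of_eq ?_))
    push_cast; ring

/-- Two curves through `1` with the same velocity differ by `o(1/n)` at time `1/n`. Telescoping
costs a factor `n` times a bounded constant, so the difference of the `n`-th powers still vanishes.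
-/
theorem tendsto_pow_sub_pow_of_hasDerivAt [NormedAlgebra ℝ 𝔸] [NormOneClass 𝔸] {f g : ℝ → 𝔸}
    {D : 𝔸} (hf : HasDerivAt f D 0) (hg : HasDerivAt g D 0) (hf0 : f 0 = 1) (hg0 : g 0 = 1) :
    Tendsto (fun n : ℕ => f ((n : ℝ)⁻¹) ^ n - g ((n : ℝ)⁻¹) ^ n) atTop (𝓝 0) := by
  have hinv : Tendsto (fun n : ℕ => ((n : ℝ)⁻¹)) atTop (𝓝 0) :=
    tendsto_inv_atTop_zero.comp tendsto_natCast_atTop_atTop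
  have growth : ∀ {h : ℝ → 𝔸}, HasDerivAt h D 0 → h 0 = 1 →
      ∀ᶠ n : ℕ in atTop, ‖h ((n : ℝ)⁻¹)‖ ≤ Real.exp ((‖D‖ + 1) * (n : ℝ)⁻¹) := by
    intro h hh h0
    have := (hasDerivAt_iff_isLittleO.mp hh).def one_pos
    filter_upwards [hinv.eventually this] with n hn
    simp only [h0, sub_zero, one_mul] at hn
    have hp : (0 : ℝ) ≤ (n : ℝ)⁻¹ := by positivity
    rw [Real.norm_of_nonneg hp] at hn
    have e : h ((n : ℝ)⁻¹) = 1 + (n : ℝ)⁻¹ • D + (h ((n : ℝ)⁻¹) - 1 - (n : ℝ)⁻¹ • D) := by abel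
    have b : ‖(n : ℝ)⁻¹ • D‖ = (n : ℝ)⁻¹ * ‖D‖ := by rw [norm_smul, Real.norm_of_nonneg hp]
    have t := norm_add₃_le (a := (1 : 𝔸)) (b := (n : ℝ)⁻¹ • D)
      (c := h ((n : ℝ)⁻¹) - 1 - (n : ℝ)⁻¹ • D)
    rw [← e, norm_one, b] at t
    have := Real.add_one_le_exp ((‖D‖ + 1) * (n : ℝ)⁻¹)
    nlinarith
  have hdiff : Tendsto (fun n : ℕ => (n : ℝ) * ‖f ((n : ℝ)⁻¹) - g ((n : ℝ)⁻¹)‖) atTop (𝓝 0) := by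
    have hd : HasDerivAt (fun t => f t - g t) (0 : 𝔸) 0 := by
      have := hf.sub hg
      rw [sub_self] at this
      exact this
    have ho := (hasDerivAt_iff_isLittleO.mp hd).comp_tendsto hinv
    have := ho.norm_norm.tendsto_div_nhds_zero
    refine this.congr' ?_
    filter_upwards [eventually_gt_atTop 0] with n hn
    simp [hf0, hg0, div_eq_mul_inv, mul_comm]
  have hbound : ∀ᶠ n : ℕ in atTop, ‖f ((n : ℝ)⁻¹) ^ n - g ((n : ℝ)⁻¹) ^ n‖ ≤
      Real.exp (‖D‖ + 1) * ((n : ℝ) * ‖f ((n : ℝ)⁻¹) - g ((n : ℝ)⁻¹)‖) := by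
    filter_upwards [growth hf hf0, growth hg hg0, eventually_gt_atTop 0] with n h1 h2 hn
    refine (norm_pow_sub_pow_le_mul (Real.one_le_exp (by positivity)) h1 h2 n).trans (le_of_eq ?_)
    have hn' : (n : ℝ) ≠ 0 := by positivity
    rw [← Real.exp_nat_mul]
    field_simp
  refine squeeze_zero_norm' hbound ?_
  simpa using hdiff.const_mul (Real.exp (‖D‖ + 1))

theorem tendsto_exp_mul_exp_pow [NormedAlgebra ℝ 𝔸] [NormOneClass 𝔸] [CompleteSpace 𝔸] (A B : 𝔸) :
    Tendsto (fun n : ℕ => (NormedSpace.exp ((n : ℝ)⁻¹ • A) * NormedSpace.exp ((n : ℝ)⁻¹ • B)) ^ n)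
      atTop (𝓝 (NormedSpace.exp (A + B))) := by
  have hA := hasDerivAt_exp_smul_const (𝕂 := ℝ) A 0
  have hB := hasDerivAt_exp_smul_const (𝕂 := ℝ) B 0
  have hAB := hasDerivAt_exp_smul_const (𝕂 := ℝ) (A + B) 0
  have hm := hA.mul hB
  simp only [zero_smul, NormedSpace.exp_zero, one_mul, mul_one] at hm hAB
  have := tendsto_pow_sub_pow_of_hasDerivAt hm hAB (by simp) (by simp)
  have := this.add_const (NormedSpace.exp (A + B))
  rw [zero_add] at this
  refine this.congr' ?_
  filter_upwards [eventually_gt_atTop 0] with n hn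
  have hn' : (n : ℝ) ≠ 0 := by positivity
  let _ : NormedAlgebra ℚ 𝔸 := NormedAlgebra.restrictScalars ℚ ℝ 𝔸
  have : NormedSpace.exp ((n : ℝ)⁻¹ • (A + B)) ^ n = NormedSpace.exp (A + B) := by
    rw [← NormedSpace.exp_nsmul, ← Nat.cast_smul_eq_nsmul ℝ, smul_smul, mul_inv_cancel₀ hn',
      one_smul]
  simp only [Pi.mul_apply, this, sub_add_cancel]

end Trotter

/-! ### The Golden–Thompson inequality. -/

section GoldenThompson

variable {d : Type*} [Fintype d]

theorem trace_mul_transpose_self_nonneg (A : Matrix d d ℝ) : 0 ≤ (A * Aᵀ).trace := by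
  simp only [trace, diag_apply, mul_apply, transpose_apply]
  exact Finset.sum_nonneg fun i _ => Finset.sum_nonneg fun j _ => mul_self_nonneg _

theorem trace_mul_sq_le (A B : Matrix d d ℝ) :
    (A * B).trace ^ 2 ≤ (A * Aᵀ).trace * (B * Bᵀ).trace := by
  have h := Finset.sum_mul_sq_le_sq_mul_sq (Finset.univ : Finset (d × d))
    (fun x => A x.1 x.2) (fun x => B x.2 x.1)
  have e1 : (A * B).trace = ∑ x : d × d, A x.1 x.2 * B x.2 x.1 := by
    simp [trace, mul_apply, Fintype.sum_prod_type]
  have e2 : (A * Aᵀ).trace = ∑ x : d × d, A x.1 x.2 ^ 2 := by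
    simp [trace, mul_apply, Fintype.sum_prod_type, sq]
  have e3 : (B * Bᵀ).trace = ∑ x : d × d, B x.2 x.1 ^ 2 := by
    rw [Fintype.sum_prod_type, Finset.sum_comm]
    simp [trace, mul_apply, sq]
  rw [e1, e2, e3]; exact h

variable [DecidableEq d]

theorem trace_mul_pow_comm (A B : Matrix d d ℝ) (k : ℕ) :
    ((A * B) ^ k).trace = ((B * A) ^ k).trace := by
  cases k with
  | zero => simp
  | succ k =>
    have h : ∀ j : ℕ, (A * B) ^ j * A = A * (B * A) ^ j := by
      intro j
      induction j with
      | zero => simp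
      | succ j ih => rw [pow_succ', pow_succ', mul_assoc, ih]; simp only [mul_assoc]
    rw [pow_succ, ← mul_assoc, h, trace_mul_comm, ← mul_assoc, ← pow_succ']

/-- The trace inequalities for `2 ^ k`-th powers behind the Golden–Thompson inequality. -/
theorem trace_two_pow_le (k : ℕ) :
    (∀ X Y : Matrix d d ℝ, Xᵀ = X → Yᵀ = Y →
      ((X * Y) ^ 2 ^ k).trace ≤ (X ^ 2 ^ k * Y ^ 2 ^ k).trace) ∧
    (∀ M : Matrix d d ℝ, (M ^ 2 ^ (k + 1)).trace ≤ ((M * Mᵀ) ^ 2 ^ k).trace) := by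
  -- The two claims feed each other. The first at `k + 1` uses the second at `k` for `X * Y` and the
  -- first at `k` for `X ^ 2`, `Y ^ 2`. The second at `k + 1` uses the second at `k` for `M ^ 2` and
  -- the first at `k` for `M * Mᵀ`, `Mᵀ * M`.
  induction k using Nat.strong_induction_on with
  | _ k ih =>
  -- Cauchy–Schwarz, to be used for equal powers of `M * Mᵀ` and `Mᵀ * M`, whose squares have the
  -- same trace.
  have hsq : ∀ S T : Matrix d d ℝ, Sᵀ = S → Tᵀ = T → (S * S).trace = (T * T).trace →
      (S * T).trace ≤ (S * S).trace := by
    intro S T hS hT h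
    have h1 := trace_mul_sq_le S T
    have h2 := trace_mul_transpose_self_nonneg S
    rw [hS, hT, ← h, ← sq] at h1
    rw [hS] at h2
    exact le_of_sq_le_sq h1 h2
  have ha : ∀ X Y : Matrix d d ℝ, Xᵀ = X → Yᵀ = Y →
      ((X * Y) ^ 2 ^ k).trace ≤ (X ^ 2 ^ k * Y ^ 2 ^ k).trace := by
    intro X Y hX hY
    cases k with
    | zero => simp
    | succ k =>
      obtain ⟨h1, h2⟩ := ih k k.lt_succ_self
      calc ((X * Y) ^ 2 ^ (k + 1)).trace ≤ ((X * Y * (X * Y)ᵀ) ^ 2 ^ k).trace := h2 _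
        _ = ((X * (Y * Y * X)) ^ 2 ^ k).trace := by
            rw [transpose_mul, hX, hY]; simp only [mul_assoc]
        _ = ((Y ^ 2 * X ^ 2) ^ 2 ^ k).trace := by
            rw [trace_mul_pow_comm]; simp only [mul_assoc, sq]
        _ = ((X ^ 2 * Y ^ 2) ^ 2 ^ k).trace := trace_mul_pow_comm _ _ _
        _ ≤ ((X ^ 2) ^ 2 ^ k * (Y ^ 2) ^ 2 ^ k).trace :=
            h1 _ _ (by rw [transpose_pow, hX]) (by rw [transpose_pow, hY])
        _ = _ := by rw [← pow_mul, ← pow_mul, ← pow_succ']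
  refine ⟨ha, fun M => ?_⟩
  cases k with
  | zero =>
    have h1 := trace_mul_sq_le M M
    rw [← sq (M * Mᵀ).trace] at h1
    simpa [sq] using le_of_sq_le_sq h1 (trace_mul_transpose_self_nonneg M)
  | succ k =>
    obtain ⟨h1, h2⟩ := ih k k.lt_succ_self
    have hP : (Mᵀ * M)ᵀ = Mᵀ * M := by simp
    have hQ : (M * Mᵀ)ᵀ = M * Mᵀ := by simp
    calc (M ^ 2 ^ (k + 1 + 1)).trace = ((M ^ 2) ^ 2 ^ (k + 1)).trace := by
          rw [← pow_mul, ← pow_succ']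
      _ ≤ ((M ^ 2 * (M ^ 2)ᵀ) ^ 2 ^ k).trace := h2 _
      _ = ((M * (M * Mᵀ * Mᵀ)) ^ 2 ^ k).trace := by
          rw [transpose_pow]; simp only [sq, mul_assoc]
      _ = ((M * Mᵀ * (Mᵀ * M)) ^ 2 ^ k).trace := by
          rw [trace_mul_pow_comm]; simp only [mul_assoc]
      _ ≤ ((M * Mᵀ) ^ 2 ^ k * (Mᵀ * M) ^ 2 ^ k).trace := h1 _ _ hQ hP
      _ ≤ ((M * Mᵀ) ^ 2 ^ k * (M * Mᵀ) ^ 2 ^ k).trace := by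
          refine hsq _ _ (by rw [transpose_pow, hQ]) (by rw [transpose_pow, hP]) ?_
          rw [← pow_add, ← pow_add, trace_mul_pow_comm]
      _ = _ := by rw [← pow_add, ← two_mul, ← pow_succ']

open scoped Norms.Operator in
/-- The Golden–Thompson inequality for real symmetric matrices. -/
theorem trace_exp_add_le (A B : Matrix d d ℝ) (hA : Aᵀ = A) (hB : Bᵀ = B) :
    (NormedSpace.exp (A + B)).trace ≤ (NormedSpace.exp A * NormedSpace.exp B).trace := by
  cases isEmpty_or_nonempty d with
  | inl h => simp [trace]
  | inr h =>
    have h1 := tendsto_exp_mul_exp_pow A B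
    -- The trace inequality is available only for exponents `2 ^ k`, so the product formula is
    -- restricted to this subsequence.
    have h2 := h1.comp (tendsto_pow_atTop_atTop_of_one_lt (one_lt_two : 1 < 2))
    have hc : Continuous fun M : Matrix d d ℝ => M.trace := by
      unfold trace; fun_prop
    refine le_of_tendsto ((hc.tendsto _).comp h2) (Filter.Eventually.of_forall fun k => ?_)
    have hsymm : ∀ C : Matrix d d ℝ, Cᵀ = C → ∀ c : ℝ,
        (NormedSpace.exp (c • C))ᵀ = NormedSpace.exp (c • C) := by
      intro C hC c
      rw [← exp_transpose, transpose_smul, hC]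
    have hpow : ∀ C : Matrix d d ℝ,
        NormedSpace.exp ((((2 ^ k : ℕ) : ℝ)⁻¹) • C) ^ 2 ^ k = NormedSpace.exp C := by
      intro C
      rw [← Matrix.exp_nsmul, ← Nat.cast_smul_eq_nsmul ℝ, smul_smul,
        mul_inv_cancel₀ (by positivity), one_smul]
    have := (trace_two_pow_le k).1 _ _ (hsymm A hA (((2 ^ k : ℕ) : ℝ)⁻¹))
      (hsymm B hB (((2 ^ k : ℕ) : ℝ)⁻¹))
    rwa [hpow, hpow] at this

end GoldenThompson

/-! ### Probability as counting on finite types. -/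

section Freq

variable {α β : Type*} [Fintype α] [Fintype β]

open Classical in
/-- The proportion of the elements of a finite type satisfying a predicate. -/
def freq (B : α → Prop) : ℝ := ((Finset.univ.filter B).card : ℝ) / Fintype.card α

open Classical in
theorem freq_eq_sum (B : α → Prop) :
    freq B = (∑ a, if B a then (1 : ℝ) else 0) / Fintype.card α := by
  simp [freq]

theorem freq_nonneg (B : α → Prop) : 0 ≤ freq B := by unfold freq; positivity

theorem freq_mono {B C : α → Prop} (h : ∀ a, B a → C a) : freq B ≤ freq C := by
  classical
  unfold freq
  gcongr
  exact h _

theorem freq_or_le (B C : α → Prop) : freq (fun a => B a ∨ C a) ≤ freq B + freq C := by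
  classical
  rw [freq_eq_sum, freq_eq_sum, freq_eq_sum, ← add_div, ← Finset.sum_add_distrib]
  gcongr with a
  split_ifs <;> simp_all

theorem freq_exists_le {τ : Type*} [Fintype τ] (B : τ → α → Prop) {δ : ℝ}
    (h : ∀ i, freq (B i) ≤ δ) : freq (fun a => ∃ i, B i a) ≤ Fintype.card τ * δ := by
  classical
  have : freq (fun a => ∃ i, B i a) ≤ ∑ i, freq (B i) := by
    simp only [freq_eq_sum]
    rw [← Finset.sum_div, Finset.sum_comm]
    gcongr with a
    have h0 : ∀ i, (0 : ℝ) ≤ if B i a then 1 else 0 := fun i => by split_ifs <;> simp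
    split_ifs with h
    · obtain ⟨i, hi⟩ := h
      refine le_trans ?_ (Finset.single_le_sum (fun j _ => h0 j) (Finset.mem_univ i))
      rw [if_pos hi]
    · exact Finset.sum_nonneg fun i _ => h0 i
  refine this.trans ((Finset.sum_le_sum fun i _ => h i).trans ?_)
  simp

theorem freq_equiv (e : α ≃ β) (B : β → Prop) : freq (fun a => B (e a)) = freq B := by
  classical
  rw [freq_eq_sum, freq_eq_sum, Fintype.card_congr e]
  congr 1
  exact Fintype.sum_equiv e _ _ fun _ => rfl

/-- Markov's inequality, in a product form that also covers an empty type. -/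
theorem freq_le_of_forall_mul_le {B : α → Prop} {f : α → ℝ} {c K : ℝ} (hf : ∀ a, 0 ≤ f a)
    (hc : 0 < c) (hB : ∀ a, B a → c ≤ f a) (hK : ∑ a, f a ≤ K * Fintype.card α) (hK0 : 0 ≤ K) :
    freq B ≤ K / c := by
  classical
  rw [freq_eq_sum]
  have h1 : (∑ a, if B a then (1 : ℝ) else 0) * c ≤ K * Fintype.card α := by
    rw [Finset.sum_mul]
    refine (Finset.sum_le_sum fun a _ => ?_).trans hK
    split_ifs with h
    · simpa using hB a h
    · simpa using hf a
  refine div_le_of_le_mul₀ (by positivity) (by positivity) ?_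
  rw [div_mul_eq_mul_div, le_div_iff₀ hc]
  exact h1

/-- A bound that holds conditionally on every value of the first coordinate holds overall. -/
theorem freq_prod_le {B : α × β → Prop} {δ : ℝ} (hδ : 0 ≤ δ)
    (h : ∀ a, freq (fun b => B (a, b)) ≤ δ) : freq B ≤ δ := by
  classical
  simp only [freq_eq_sum] at h ⊢
  refine div_le_of_le_mul₀ (by positivity) hδ ?_
  rw [Fintype.sum_prod_type, Fintype.card_prod]
  have : ∀ a, (∑ b, if B (a, b) then (1 : ℝ) else 0) ≤ δ * Fintype.card β := by
    intro a
    rcases isEmpty_or_nonempty β with hβ | hβ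
    · simp
    · have := h a
      rwa [div_le_iff₀ (by exact_mod_cast Fintype.card_pos)] at this
  refine (Finset.sum_le_sum fun a _ => this a).trans (le_of_eq ?_)
  simp; ring

theorem freq_comp_fst_le (B : α → Prop) : freq (fun x : α × β => B x.1) ≤ freq B := by
  classical
  simp only [freq_eq_sum]
  rw [Fintype.sum_prod_type, Fintype.card_prod]
  rcases isEmpty_or_nonempty β with hβ | hβ
  · simp; positivity
  · have : (Fintype.card β : ℝ) ≠ 0 := by exact_mod_cast Fintype.card_ne_zero
    have hc : ∀ a, ∑ _b : β, (if B a then (1 : ℝ) else 0)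
        = Fintype.card β * if B a then (1 : ℝ) else 0 := fun a => by
      rw [Finset.sum_const, Finset.card_univ, nsmul_eq_mul]
    rw [Finset.sum_congr rfl fun a _ => hc a, ← Finset.mul_sum, Nat.cast_mul,
      mul_comm (Fintype.card α : ℝ), mul_div_mul_left _ _ this]

end Freq

/-! ### Matrix Bernstein inequality. -/

section Bernstein

/-- Beyond the linear term the Taylor bound contributes at most `1/2 + 1/6 + 5/96 < 3/4` times `x ^
2`. -/
theorem Real.exp_le_one_add_add_sq {x : ℝ} (hx : |x| ≤ 1) :
    Real.exp x ≤ 1 + x + 3 / 4 * x ^ 2 := by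
  have h := Real.exp_bound hx (n := 4) (by norm_num)
  have hs : ∑ m ∈ Finset.range 4, x ^ m / (m.factorial : ℝ)
      = 1 + x + x ^ 2 / 2 + x ^ 3 / 6 := by
    simp [Finset.sum_range_succ, Nat.factorial]
  rw [hs] at h
  have h4 : |x| ^ 4 = x ^ 4 := by rw [← abs_pow, abs_of_nonneg (by positivity)]
  rw [h4] at h
  norm_num [Nat.factorial] at h
  have h1 := (abs_le.mp h).2
  obtain ⟨hl, hr⟩ := abs_le.mp hx
  have h5 : x ^ 3 ≤ x ^ 2 := by nlinarith [sq_nonneg x]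
  have h6 : x ^ 4 ≤ x ^ 2 := by nlinarith [mul_nonneg (sq_nonneg x) (show 0 ≤ 1 - x ^ 2 by nlinarith)]
  linarith [sq_nonneg x]

variable {d : Type*} [Fintype d] [DecidableEq d]

theorem exists_orthogonal_diagonalization {S : Matrix d d ℝ} (hS : Sᵀ = S) :
    ∃ (W : Matrix d d ℝ) (l : d → ℝ), Wᵀ * W = 1 ∧ W * Wᵀ = 1 ∧ S = W * diagonal l * Wᵀ := by
  have hH : S.IsHermitian := by rw [IsHermitian, conjTranspose_eq_transpose_of_trivial, hS]
  refine ⟨hH.eigenvectorUnitary, hH.eigenvalues, ?_, ?_, ?_⟩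
  · have := Unitary.coe_star_mul_self hH.eigenvectorUnitary
    rwa [star_eq_conjTranspose, conjTranspose_eq_transpose_of_trivial] at this
  · have := Unitary.coe_mul_star_self hH.eigenvectorUnitary
    rwa [Unitary.coe_star, star_eq_conjTranspose,
      conjTranspose_eq_transpose_of_trivial] at this
  · have := hH.spectral_theorem
    rw [Unitary.conjStarAlgAut_apply, star_eq_conjTranspose,
      conjTranspose_eq_transpose_of_trivial] at this
    exact this

theorem dotProduct_conj_diagonal (W : Matrix d d ℝ) (f v : d → ℝ) :
    v ⬝ᵥ (W * diagonal f * Wᵀ) *ᵥ v = ∑ i, f i * (Wᵀ *ᵥ v) i ^ 2 := by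
  rw [← mulVec_mulVec, ← mulVec_mulVec, dotProduct_mulVec, ← mulVec_transpose]
  simp only [dotProduct, mulVec_diagonal]
  exact Finset.sum_congr rfl fun i _ => by ring

theorem dotProduct_self_eq_sum_of_orthogonal {W : Matrix d d ℝ} (hW : W * Wᵀ = 1) (v : d → ℝ) :
    v ⬝ᵥ v = ∑ i, (Wᵀ *ᵥ v) i ^ 2 := by
  have := dotProduct_conj_diagonal W 1 v
  simpa [hW] using this

theorem exp_conj_diagonal {W : Matrix d d ℝ} (hW : Wᵀ * W = 1) (l : d → ℝ) :
    NormedSpace.exp (W * diagonal l * Wᵀ) = W * diagonal (fun i => Real.exp (l i)) * Wᵀ := by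
  have hinv : W⁻¹ = Wᵀ := inv_eq_left_inv hW
  have hu : IsUnit W := by
    rw [isUnit_iff_isUnit_det]; exact isUnit_det_of_left_inverse hW
  rw [← hinv, exp_conj _ _ hu, exp_diagonal]
  congr 3
  ext i
  rw [Pi.coe_exp, Real.exp_eq_exp_ℝ]

/-- The scalar inequality holds at each eigenvalue, since testing the hypothesis on eigenvectors
places the spectrum in `[-1, 1]`. -/
theorem dotProduct_exp_mulVec_le {S : Matrix d d ℝ} (hS : Sᵀ = S)
    (hb : ∀ v, |v ⬝ᵥ S *ᵥ v| ≤ v ⬝ᵥ v) (v : d → ℝ) :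
    v ⬝ᵥ NormedSpace.exp S *ᵥ v ≤ v ⬝ᵥ v + v ⬝ᵥ S *ᵥ v + 3 / 4 * (S *ᵥ v ⬝ᵥ S *ᵥ v) := by
  obtain ⟨W, l, h1, h2, rfl⟩ := exists_orthogonal_diagonalization hS
  have hl : ∀ i, |l i| ≤ 1 := by
    intro i
    have := hb (W *ᵥ Pi.single i 1)
    rw [dotProduct_conj_diagonal, dotProduct_self_eq_sum_of_orthogonal h2, mulVec_mulVec, h1,
      one_mulVec] at this
    simpa [Pi.single_apply] using this
  have e3 : (W * diagonal l * Wᵀ) *ᵥ v ⬝ᵥ (W * diagonal l * Wᵀ) *ᵥ v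
      = v ⬝ᵥ (W * diagonal (fun i => l i ^ 2) * Wᵀ) *ᵥ v := by
    have hdd : (fun i => l i ^ 2) = fun i => l i * l i := by ext i; ring
    rw [hdd, ← diagonal_mul_diagonal, dotProduct_comm, ← dotProduct_transpose_mulVec,
      mulVec_mulVec, hS]
    congr 2
    calc W * diagonal l * Wᵀ * (W * diagonal l * Wᵀ)
        = W * diagonal l * (Wᵀ * W) * diagonal l * Wᵀ := by simp only [mul_assoc]
      _ = _ := by rw [h1]; simp only [mul_assoc, mul_one]
  rw [e3, exp_conj_diagonal h1, dotProduct_conj_diagonal, dotProduct_conj_diagonal,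
    dotProduct_conj_diagonal, dotProduct_self_eq_sum_of_orthogonal h2, Finset.mul_sum,
    ← Finset.sum_add_distrib, ← Finset.sum_add_distrib]
  refine Finset.sum_le_sum fun i _ => ?_
  have := mul_le_mul_of_nonneg_right (Real.exp_le_one_add_add_sq (hl i))
    (sq_nonneg ((Wᵀ *ᵥ v) i))
  linarith

theorem trace_conj_diagonal {W : Matrix d d ℝ} (f : d → ℝ) (E : Matrix d d ℝ) :
    (W * diagonal f * Wᵀ * E).trace
      = ∑ i, f i * ((W *ᵥ Pi.single i 1) ⬝ᵥ E *ᵥ (W *ᵥ Pi.single i 1)) := by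
  have : (W * diagonal f * Wᵀ * E).trace = (diagonal f * (Wᵀ * E * W)).trace := by
    rw [mul_assoc, mul_assoc, trace_mul_comm]; simp only [mul_assoc]
  rw [this, trace]
  refine Finset.sum_congr rfl fun i _ => ?_
  rw [diag_apply, diagonal_mul]
  congr 1
  rw [mulVec_single_one, mul_assoc, mul_apply]
  simp only [dotProduct, mulVec, mul_apply, transpose_apply, col_apply]

/-- In an eigenbasis of `S` the left side is a combination of values of the quadratic form of `E` at
unit vectors, with the positive weights `exp (l i)`. -/
theorem trace_exp_mul_le {S E : Matrix d d ℝ} (hS : Sᵀ = S) {b : ℝ}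
    (hE : ∀ v, v ⬝ᵥ E *ᵥ v ≤ b * (v ⬝ᵥ v)) :
    (NormedSpace.exp S * E).trace ≤ b * (NormedSpace.exp S).trace := by
  obtain ⟨W, l, h1, h2, rfl⟩ := exists_orthogonal_diagonalization hS
  have ht := trace_conj_diagonal (W := W) (fun i => Real.exp (l i)) 1
  rw [mul_one] at ht
  rw [exp_conj_diagonal h1, trace_conj_diagonal, ht, Finset.mul_sum]
  refine Finset.sum_le_sum fun i _ => ?_
  have := mul_le_mul_of_nonneg_left (hE (W *ᵥ Pi.single i 1)) (Real.exp_pos (l i)).le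
  rw [one_mulVec]
  linarith

/-- Some eigenvalue of `S` is at least `t`, and the trace of the exponential is a sum of positive
terms that includes this one. -/
theorem exp_le_trace_exp {S : Matrix d d ℝ} (hS : Sᵀ = S) {t : ℝ}
    (h : ∃ v, t * (v ⬝ᵥ v) < v ⬝ᵥ S *ᵥ v) : Real.exp t ≤ (NormedSpace.exp S).trace := by
  obtain ⟨W, l, h1, h2, rfl⟩ := exists_orthogonal_diagonalization hS
  obtain ⟨v, hv⟩ := h
  have ht : (NormedSpace.exp (W * diagonal l * Wᵀ)).trace = ∑ i, Real.exp (l i) := by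
    rw [exp_conj_diagonal h1, mul_assoc, trace_mul_comm, mul_assoc, h1, mul_one, trace_diagonal]
  rw [dotProduct_conj_diagonal, dotProduct_self_eq_sum_of_orthogonal h2, Finset.mul_sum] at hv
  obtain ⟨i, -, hi⟩ := Finset.exists_lt_of_sum_lt hv
  have hti : t ≤ l i := by
    by_contra hc
    exact absurd hi (not_lt.mpr (mul_le_mul_of_nonneg_right (not_le.mp hc).le (sq_nonneg _)))
  rw [ht]
  exact (Real.exp_le_exp.mpr hti).trans
    (Finset.single_le_sum (f := fun i => Real.exp (l i)) (fun j _ => (Real.exp_pos _).le)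
      (Finset.mem_univ i))

theorem trace_exp_nonneg {S : Matrix d d ℝ} (hS : Sᵀ = S) :
    0 ≤ (NormedSpace.exp S).trace := by
  obtain ⟨W, l, h1, h2, rfl⟩ := exists_orthogonal_diagonalization hS
  rw [exp_conj_diagonal h1, mul_assoc, trace_mul_comm, mul_assoc, h1, mul_one, trace_diagonal]
  exact Finset.sum_nonneg fun i _ => (Real.exp_pos _).le

variable {ι : Type*} [Fintype ι]

/-- The Ahlswede–Winter bound on the trace of the matrix moment generating function of a sum of
independent uniform samples. -/
theorem sum_trace_exp_sum_le (Y : ι → Matrix d d ℝ) (hY : ∀ a, (Y a)ᵀ = Y a) {b : ℝ} (hb : 0 ≤ b)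
    (hE : ∀ v, ∑ a, v ⬝ᵥ NormedSpace.exp (Y a) *ᵥ v ≤ b * (v ⬝ᵥ v)) (n : ℕ) :
    ∑ w : Fin n → ι, (NormedSpace.exp (∑ k, Y (w k))).trace ≤ b ^ n * Fintype.card d := by
  induction n with
  | zero => simp
  | succ n ih =>
    -- One sample `a` is split off: Golden–Thompson separates `exp (Y a)` from the other samples,
    -- and its sum over `a` is then bounded as a quadratic form.
    rw [← (Fin.consEquiv fun _ : Fin (n + 1) => ι).sum_comp, Fintype.sum_prod_type,
      Finset.sum_comm]
    calc ∑ w : Fin n → ι, ∑ a : ι, (NormedSpace.exp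
          (∑ k, Y ((Fin.consEquiv fun _ : Fin (n + 1) => ι) (a, w) k))).trace
        ≤ ∑ w : Fin n → ι, b * (NormedSpace.exp (∑ k, Y (w k))).trace := by
          refine Finset.sum_le_sum fun w _ => ?_
          have hS : (∑ k, Y (w k))ᵀ = ∑ k, Y (w k) := by
            rw [transpose_sum]; exact Finset.sum_congr rfl fun k _ => hY _
          calc _ ≤ ∑ a, (NormedSpace.exp (∑ k, Y (w k)) * NormedSpace.exp (Y a)).trace := by
                refine Finset.sum_le_sum fun a _ => ?_
                simp only [Fin.consEquiv_apply, Fin.sum_univ_succ, Fin.cons_zero, Fin.cons_succ]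
                rw [add_comm]
                exact trace_exp_add_le _ _ hS (hY a)
            _ = (NormedSpace.exp (∑ k, Y (w k)) * ∑ a, NormedSpace.exp (Y a)).trace := by
                rw [Matrix.mul_sum, trace_sum]
            _ ≤ _ := by
                refine trace_exp_mul_le hS fun v => ?_
                rw [sum_mulVec, dotProduct_sum]
                exact hE v
      _ = b * ∑ w : Fin n → ι, (NormedSpace.exp (∑ k, Y (w k))).trace := by rw [Finset.mul_sum]
      _ ≤ b * (b ^ n * Fintype.card d) := mul_le_mul_of_nonneg_left ih hb
      _ = _ := by ring

/-- A matrix Bernstein inequality for sums of independent uniform samples from a finite family of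
symmetric matrices, stated for quadratic forms. -/
theorem freq_exists_quadraticForm_gt_le {κ : Type*} [Fintype κ] [DecidableEq κ]
    (X : ι → Matrix d d ℝ)
    (hX : ∀ a, (X a)ᵀ = X a) (hsum : ∀ v, ∑ a, v ⬝ᵥ X a *ᵥ v = 0) {R s θ t : ℝ}
    (hR : ∀ a v, |v ⬝ᵥ X a *ᵥ v| ≤ R * (v ⬝ᵥ v))
    (hs : ∀ v, ∑ a, (X a *ᵥ v) ⬝ᵥ (X a *ᵥ v) ≤ Fintype.card ι * s * (v ⬝ᵥ v))
    (hs0 : 0 ≤ s) (hθ : 0 < θ) (hθR : θ * R ≤ 1) :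
    freq (fun w : κ → ι => ∃ v : d → ℝ, t * (v ⬝ᵥ v) < ∑ k, v ⬝ᵥ X (w k) *ᵥ v)
      ≤ Fintype.card d * Real.exp (-(θ * t) + Fintype.card κ * (3 / 4 * θ ^ 2 * s)) := by
  classical
  set n := Fintype.card κ with hn
  let e : (Fin n → ι) ≃ (κ → ι) := Equiv.arrowCongr (Fintype.equivFin κ).symm (Equiv.refl ι)
  rw [← freq_equiv e]
  have hpre : ∀ (w : Fin n → ι) (v : d → ℝ), ∑ k, v ⬝ᵥ X (e w k) *ᵥ v
      = ∑ k, v ⬝ᵥ X (w k) *ᵥ v := fun w v =>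
    Fintype.sum_equiv (Fintype.equivFin κ) _ _ fun k => rfl
  simp only [hpre]
  set g : ℝ := 3 / 4 * θ ^ 2 * s with hg
  have hg0 : 0 ≤ g := by positivity
  have hY : ∀ a, (θ • X a)ᵀ = θ • X a := fun a => by rw [transpose_smul, hX]
  have hv0 : ∀ v : d → ℝ, 0 ≤ v ⬝ᵥ v := fun v =>
    Finset.sum_nonneg fun i _ => mul_self_nonneg _
  -- Summing over `a` kills the linear term, and `1 + g ≤ exp g` absorbs the quadratic one.
  have hE : ∀ v, ∑ a, v ⬝ᵥ NormedSpace.exp (θ • X a) *ᵥ v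
      ≤ Fintype.card ι * Real.exp g * (v ⬝ᵥ v) := by
    intro v
    have step : ∀ a, v ⬝ᵥ NormedSpace.exp (θ • X a) *ᵥ v ≤ v ⬝ᵥ v + θ * (v ⬝ᵥ X a *ᵥ v)
        + 3 / 4 * θ ^ 2 * ((X a *ᵥ v) ⬝ᵥ (X a *ᵥ v)) := by
      intro a
      have := dotProduct_exp_mulVec_le (hY a) (fun u => ?_) v
      · simp only [smul_mulVec, dotProduct_smul, smul_dotProduct, smul_eq_mul] at this
        linarith
      · rw [smul_mulVec, dotProduct_smul, smul_eq_mul, abs_mul, abs_of_pos hθ]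
        have h1 := mul_le_mul_of_nonneg_left (hR a u) hθ.le
        have h2 := mul_le_mul_of_nonneg_right hθR (hv0 u)
        linarith
    refine (Finset.sum_le_sum fun a _ => step a).trans ?_
    rw [Finset.sum_add_distrib, Finset.sum_add_distrib, ← Finset.mul_sum, ← Finset.mul_sum, hsum,
      Finset.sum_const, Finset.card_univ, nsmul_eq_mul]
    have h1 := mul_le_mul_of_nonneg_left (hs v) (show 0 ≤ 3 / 4 * θ ^ 2 by positivity)
    have h2 := mul_le_mul_of_nonneg_left (Real.add_one_le_exp g)
      (mul_nonneg (Nat.cast_nonneg (α := ℝ) (Fintype.card ι)) (hv0 v))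
    rw [hg] at h2 ⊢
    linarith
  have hmain := sum_trace_exp_sum_le (fun a => θ • X a) hY (by positivity) hE n
  have hS : ∀ w : Fin n → ι, (∑ k, θ • X (w k))ᵀ = ∑ k, θ • X (w k) := by
    intro w; rw [transpose_sum]; exact Finset.sum_congr rfl fun k _ => hY _
  have := freq_le_of_forall_mul_le (α := Fin n → ι)
    (B := fun w => ∃ v : d → ℝ, t * (v ⬝ᵥ v) < ∑ k, v ⬝ᵥ X (w k) *ᵥ v)
    (f := fun w => (NormedSpace.exp (∑ k, θ • X (w k))).trace) (c := Real.exp (θ * t))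
    (K := Fintype.card d * Real.exp (n * g)) (fun w => trace_exp_nonneg (hS w)) (Real.exp_pos _)
    (fun w ⟨v, hv⟩ => exp_le_trace_exp (hS w) ⟨v, ?_⟩) ?_ (by positivity)
  · refine this.trans (le_of_eq ?_)
    rw [mul_div_assoc, ← Real.exp_sub]
    congr 2; ring
  · rw [sum_mulVec, dotProduct_sum]
    simp only [smul_mulVec, dotProduct_smul, smul_eq_mul, ← Finset.mul_sum]
    rw [mul_assoc]
    exact mul_lt_mul_of_pos_left hv hθ
  · refine hmain.trans (le_of_eq ?_)
    rw [mul_pow, ← Real.exp_nat_mul, Fintype.card_fun, Fintype.card_fin]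
    push_cast; ring

end Bernstein

/-! ### From sampling without replacement to sampling with replacement. -/

section Sampling

theorem IsUniformSample.le_card {ι : Type*} [Fintype ι] {S : Type*} [MeasurableSpace S]
    {P : Measure S} [IsProbabilityMeasure P] {m : ℕ} {Ω : S → Finset ι}
    (hΩ : IsUniformSample P Ω m) : m ≤ Fintype.card ι := by
  obtain ⟨s, hs⟩ := hΩ.card_eq.exists
  rw [← hs]
  exact Finset.card_le_univ _

variable {ι : Type*} [Fintype ι] [DecidableEq ι]

theorem exists_perm_map_eq {A B : Finset ι} (h : A.card = B.card) :
    ∃ τ : Equiv.Perm ι, A.map τ.toEmbedding = B := by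
  let e : {x // x ∈ A} ≃ {x // x ∈ B} := Finset.equivOfCardEq h
  refine ⟨e.extendSubtype, Finset.eq_of_subset_of_card_le (fun x hx => ?_) (by simp [h])⟩
  obtain ⟨y, hy, rfl⟩ := Finset.mem_map.mp hx
  exact e.extendSubtype_mem y hy

-- The image of a fixed set under a uniform permutation is uniform among sets of its size:
-- permutations act transitively on these sets, so the frequency depends only on the size and may be
-- averaged over all of them.
open Classical in
theorem freq_perm_map (Bad : Finset ι → Prop) (A : Finset ι) :
    freq (fun π : Equiv.Perm ι => Bad (A.map π.toEmbedding)) * (Fintype.card ι).choose A.card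
      = ((Finset.powersetCard A.card (Finset.univ : Finset ι)).filter Bad).card := by
  set F := Finset.powersetCard A.card (Finset.univ : Finset ι) with hF
  have hind : ∀ B ∈ F, freq (fun π : Equiv.Perm ι => Bad (B.map π.toEmbedding))
      = freq (fun π : Equiv.Perm ι => Bad (A.map π.toEmbedding)) := by
    intro B hB
    obtain ⟨τ, rfl⟩ := exists_perm_map_eq (Finset.mem_powersetCard.mp hB).2.symm
    rw [← freq_equiv (Equiv.mulRight τ) fun π : Equiv.Perm ι => Bad (A.map π.toEmbedding)]
    congr 1
    ext π
    rw [Finset.map_map]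
    rfl
  have h1 : ∑ B ∈ F, freq (fun π : Equiv.Perm ι => Bad (B.map π.toEmbedding))
      = freq (fun π : Equiv.Perm ι => Bad (A.map π.toEmbedding))
        * (Fintype.card ι).choose A.card := by
    rw [Finset.sum_congr rfl hind, Finset.sum_const, hF, Finset.card_powersetCard,
      Finset.card_univ, nsmul_eq_mul, mul_comm]
  rw [← h1]
  simp only [freq_eq_sum]
  rw [← Finset.sum_div, Finset.sum_comm]
  have h2 : ∀ π : Equiv.Perm ι, ∑ B ∈ F, (if Bad (B.map π.toEmbedding) then (1 : ℝ) else 0)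
      = (F.filter Bad).card := by
    intro π
    rw [Finset.card_filter]
    push_cast
    refine Finset.sum_bij (fun B _ => B.map π.toEmbedding) ?_ ?_ ?_ ?_
    · intro B hB
      simpa [hF] using hB
    · intro B _ C _ h
      exact Finset.map_injective _ h
    · intro C hC
      refine ⟨C.map π.symm.toEmbedding, by simpa [hF] using hC, ?_⟩
      rw [Finset.map_map]
      ext x
      simp
    · intro B _
      rfl
  rw [Finset.sum_congr rfl fun π _ => h2 π, Finset.sum_const, nsmul_eq_mul, Finset.card_univ,
    mul_comm, mul_div_assoc, div_self (by exact_mod_cast Fintype.card_ne_zero), mul_one]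

open Classical in
/-- Sampling without replacement is at most as likely as sampling with replacement to fall into a
family of sets that is closed under passing to subsets. -/
theorem card_filter_powersetCard_le_freq {κ : Type*} [Fintype κ] [DecidableEq κ] {m : ℕ}
    (hκ : Fintype.card κ ≤ m) (hm : m ≤ Fintype.card ι) {Bad : Finset ι → Prop}
    (hBad : ∀ A B, A ⊆ B → Bad B → Bad A) :
    (((Finset.powersetCard m (Finset.univ : Finset ι)).filter Bad).card : ℝ)
        / (Fintype.card ι).choose m
      ≤ freq fun w : κ → ι => Bad (Finset.univ.image w) := by
  rcases isEmpty_or_nonempty (κ → ι) with hE | hE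
  · obtain ⟨hk, hi⟩ := isEmpty_fun.mp hE
    have : 1 ≤ Fintype.card κ := Fintype.card_pos
    have : Fintype.card ι = 0 := Fintype.card_eq_zero
    omega
  have hC : (0 : ℝ) < (Fintype.card ι).choose m := by exact_mod_cast Nat.choose_pos hm
  set δ : ℝ := (((Finset.powersetCard m (Finset.univ : Finset ι)).filter Bad).card : ℝ)
        / (Fintype.card ι).choose m with hδ
  -- The image of `w` lies in a set `A` of size `m`. A uniform permutation makes `A` a uniform
  -- `m`-set, and whenever that is bad so is the smaller permuted image of `w`.
  have h1 : ∀ w : κ → ι, δ * Fintype.card (Equiv.Perm ι)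
      ≤ ∑ π : Equiv.Perm ι, if Bad (Finset.univ.image fun k => π (w k)) then (1 : ℝ) else 0 := by
    intro w
    have hcard : (Finset.univ.image w).card ≤ m := Finset.card_image_le.trans hκ
    obtain ⟨A, hwA, -, hA⟩ := Finset.exists_subsuperset_card_eq (Finset.subset_univ _) hcard
      (by simpa using hm)
    have h2 := freq_perm_map Bad A
    rw [hA] at h2
    have h3 : δ = freq fun π : Equiv.Perm ι => Bad (A.map π.toEmbedding) := by
      rw [hδ, ← h2, mul_div_assoc, div_self hC.ne', mul_one]
    rw [h3, freq_eq_sum, div_mul_cancel₀ _ (by exact_mod_cast Fintype.card_ne_zero)]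
    refine Finset.sum_le_sum fun π _ => ?_
    have himp : Bad (A.map π.toEmbedding) → Bad (Finset.univ.image fun k => π (w k)) := by
      refine hBad _ _ fun x hx => ?_
      obtain ⟨k, -, rfl⟩ := Finset.mem_image.mp hx
      exact Finset.mem_map_of_mem _ (hwA (Finset.mem_image_of_mem _ (Finset.mem_univ k)))
    split_ifs <;> simp_all
  -- Composition with a fixed permutation only relabels the words `w`.
  have h4 : ∀ π : Equiv.Perm ι,
      ∑ w : κ → ι, (if Bad (Finset.univ.image fun k => π (w k)) then (1 : ℝ) else 0)
        = ∑ w : κ → ι, if Bad (Finset.univ.image w) then (1 : ℝ) else 0 := fun π =>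
    Fintype.sum_equiv (Equiv.arrowCongr (Equiv.refl κ) π) _ _ fun w => rfl
  have h5 := Finset.sum_le_sum fun w (_ : w ∈ (Finset.univ : Finset (κ → ι))) => h1 w
  rw [Finset.sum_comm, Finset.sum_congr rfl fun π _ => h4 π, Finset.sum_const, Finset.sum_const,
    Finset.card_univ, Finset.card_univ, nsmul_eq_mul, nsmul_eq_mul] at h5
  have hP : (0 : ℝ) < Fintype.card (Equiv.Perm ι) := by exact_mod_cast Fintype.card_pos
  have hK : (0 : ℝ) < Fintype.card (κ → ι) := by exact_mod_cast Fintype.card_pos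
  rw [freq_eq_sum, le_div_iff₀ hK]
  refine le_of_mul_le_mul_left ?_ hP
  linarith

variable {S : Type*} [MeasurableSpace S] {P : Measure S} [IsProbabilityMeasure P] {m : ℕ}
  {Ω : S → Finset ι}

theorem IsUniformSample.one_sub_freq_le (hΩ : IsUniformSample P Ω m) {κ : Type*} [Fintype κ]
    [DecidableEq κ] (hκ : Fintype.card κ ≤ m) {Good : Finset ι → Prop}
    (hGood : ∀ A B, A ⊆ B → Good A → Good B) :
    1 - freq (fun w : κ → ι => ¬ Good (Finset.univ.image w)) ≤ P.real {s | Good (Ω s)} := by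
  classical
  have hunion : ∀ Q : Finset ι → Prop,
      {s | Q (Ω s)} = ⋃ A ∈ (Finset.univ.filter Q : Finset (Finset ι)), {s | Ω s = A} := by
    intro Q; ext s; simp
  have hmeas : ∀ Q : Finset ι → Prop, MeasurableSet {s | Q (Ω s)} := fun Q => by
    rw [hunion]; exact Finset.measurableSet_biUnion _ fun A _ => hΩ.measurable A
  have hcompl : {s | Good (Ω s)} = {s | ¬ Good (Ω s)}ᶜ := by ext s; simp
  rw [hcompl, probReal_compl_eq_one_sub (hmeas fun A => ¬ Good A)]
  refine sub_le_sub_left ?_ 1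
  refine le_trans ?_ (card_filter_powersetCard_le_freq (m := m) hκ hΩ.le_card
    (Bad := fun A => ¬ Good A) fun A B hAB hB hA => hB (hGood A B hAB hA))
  have hae : P.real {s | ¬ Good (Ω s)} = P.real {s | ¬ Good (Ω s) ∧ (Ω s).card = m} := by
    refine measureReal_congr ?_
    filter_upwards [hΩ.card_eq] with s hs
    exact propext ⟨fun h => ⟨h, hs⟩, fun h => h.1⟩
  rw [hae, hunion fun A => ¬ Good A ∧ A.card = m]
  refine (measureReal_biUnion_finset_le _ _).trans (le_of_eq ?_)
  rw [Finset.sum_congr rfl (g := fun _ => 1 / ((Fintype.card ι).choose m : ℝ))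
    fun A hA => hΩ.prob_eq A (by
      simp only [Finset.mem_filter] at hA
      exact hA.2.2), Finset.sum_const, nsmul_eq_mul,
    mul_one_div]
  congr 3
  ext A
  simp [Finset.mem_powersetCard, and_comm]

end Sampling

/-! ### Duality between the nuclear and spectral norms. -/

section NuclearNorm

/-- The Frobenius inner product of two real matrices. -/
def frobInner {m n : Type*} [Fintype m] [Fintype n] (A B : Matrix m n ℝ) : ℝ :=
  ∑ i, ∑ j, A i j * B i j

/-- The spectral norm of `Y` is at most `c`, expressed through bilinear forms. -/
def SpectralLe {m n : Type*} [Fintype m] [Fintype n] (Y : Matrix m n ℝ) (c : ℝ) : Prop :=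
  ∀ x y, 2 * (x ⬝ᵥ Y *ᵥ y) ≤ c * (x ⬝ᵥ x + y ⬝ᵥ y)

variable {m n : Type*} [Fintype m] [Fintype n]

theorem dotProduct_self_nonneg' (x : m → ℝ) : 0 ≤ x ⬝ᵥ x :=
  Finset.sum_nonneg fun _ _ => mul_self_nonneg _

theorem frobInner_add_left (A B C : Matrix m n ℝ) :
    frobInner (A + B) C = frobInner A C + frobInner B C := by
  simp [frobInner, add_mul, Finset.sum_add_distrib]

theorem frobInner_sub_left (A B C : Matrix m n ℝ) :
    frobInner (A - B) C = frobInner A C - frobInner B C := by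
  simp [frobInner, sub_mul, Finset.sum_sub_distrib]

theorem frobInner_add_right (A B C : Matrix m n ℝ) :
    frobInner A (B + C) = frobInner A B + frobInner A C := by
  simp [frobInner, mul_add, Finset.sum_add_distrib]

theorem frobInner_comm (A B : Matrix m n ℝ) : frobInner A B = frobInner B A := by
  simp [frobInner, mul_comm]

theorem frobInner_smul_left (c : ℝ) (A B : Matrix m n ℝ) :
    frobInner (c • A) B = c * frobInner A B := by
  simp [frobInner, Finset.mul_sum, mul_assoc]

theorem frobInner_smul_right (c : ℝ) (A B : Matrix m n ℝ) :
    frobInner A (c • B) = c * frobInner A B := by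
  rw [frobInner_comm, frobInner_smul_left, frobInner_comm]

theorem frobInner_sum_right {τ : Type*} (s : Finset τ) (A : Matrix m n ℝ)
    (B : τ → Matrix m n ℝ) : frobInner A (∑ k ∈ s, B k) = ∑ k ∈ s, frobInner A (B k) := by
  classical
  induction s using Finset.induction_on with
  | empty => simp [frobInner]
  | insert a s ha ih => rw [Finset.sum_insert ha, Finset.sum_insert ha, frobInner_add_right, ih]

theorem frobInner_vecMulVec (A : Matrix m n ℝ) (x : m → ℝ) (y : n → ℝ) :
    frobInner A (vecMulVec x y) = x ⬝ᵥ A *ᵥ y := by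
  simp only [frobInner, vecMulVec_apply, dotProduct, mulVec, Finset.mul_sum]
  exact Finset.sum_congr rfl fun i _ => Finset.sum_congr rfl fun j _ => by ring

theorem frobInner_eq_trace (A B : Matrix m n ℝ) : frobInner A B = (Aᵀ * B).trace := by
  simp only [frobInner, trace, diag_apply, mul_apply, transpose_apply]
  exact Finset.sum_comm

theorem frobInner_self_nonneg (A : Matrix m n ℝ) : 0 ≤ frobInner A A :=
  Finset.sum_nonneg fun _ _ => Finset.sum_nonneg fun _ _ => mul_self_nonneg _

theorem frobInner_self_eq_zero {A : Matrix m n ℝ} (h : frobInner A A = 0) : A = 0 := by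
  ext i j
  have h1 := (Finset.sum_eq_zero_iff_of_nonneg fun i _ =>
    Finset.sum_nonneg fun j _ => mul_self_nonneg (A i j)).mp h i (Finset.mem_univ i)
  have h2 := (Finset.sum_eq_zero_iff_of_nonneg fun j _ => mul_self_nonneg (A i j)).mp h1 j
    (Finset.mem_univ j)
  simpa using h2

theorem frobInner_sq_le (A B : Matrix m n ℝ) :
    frobInner A B ^ 2 ≤ frobInner A A * frobInner B B := by
  have h := Finset.sum_mul_sq_le_sq_mul_sq (Finset.univ : Finset (m × n))
    (fun x => A x.1 x.2) (fun x => B x.1 x.2)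
  simpa [frobInner, Fintype.sum_prod_type, sq] using h

theorem SpectralLe.add {Y Z : Matrix m n ℝ} {c c' : ℝ} (hY : SpectralLe Y c)
    (hZ : SpectralLe Z c') : SpectralLe (Y + Z) (c + c') := by
  intro x y
  have h1 := hY x y
  have h2 := hZ x y
  rw [add_mulVec, dotProduct_add]
  linarith

theorem SpectralLe.mono {Y : Matrix m n ℝ} {c c' : ℝ} (hY : SpectralLe Y c) (h : c ≤ c') :
    SpectralLe Y c' := by
  intro x y
  refine (hY x y).trans (mul_le_mul_of_nonneg_right h ?_)
  exact add_nonneg (dotProduct_self_nonneg' x) (dotProduct_self_nonneg' y)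

/-- Bessel's inequality. Vectors shorter than one are admitted because left singular vectors may be
zero. -/
theorem sum_dotProduct_sq_le {τ : Type*} [Fintype τ] [DecidableEq τ] (w : τ → m → ℝ)
    (horth : ∀ i j, i ≠ j → w i ⬝ᵥ w j = 0) (hnorm : ∀ i, w i ⬝ᵥ w i ≤ 1) (x : m → ℝ) :
    ∑ i, (x ⬝ᵥ w i) ^ 2 ≤ x ⬝ᵥ x := by
  set z : m → ℝ := ∑ i, (x ⬝ᵥ w i) • w i with hz
  have h0 := dotProduct_self_nonneg' (x - z)
  have h1 : x ⬝ᵥ z = ∑ i, (x ⬝ᵥ w i) ^ 2 := by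
    rw [hz, dotProduct_sum]
    exact Finset.sum_congr rfl fun i _ => by rw [dotProduct_smul, smul_eq_mul, sq]
  have h2 : z ⬝ᵥ z ≤ ∑ i, (x ⬝ᵥ w i) ^ 2 := by
    have : z ⬝ᵥ z = ∑ i, (x ⬝ᵥ w i) ^ 2 * (w i ⬝ᵥ w i) := by
      conv_lhs => rw [hz]
      rw [sum_dotProduct]
      refine Finset.sum_congr rfl fun i _ => ?_
      rw [dotProduct_sum, Finset.sum_eq_single i]
      · simp only [smul_dotProduct, dotProduct_smul, smul_eq_mul]; ring
      · intro j _ hj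
        simp [smul_dotProduct, dotProduct_smul, horth i j hj.symm]
      · simp
    rw [this]
    exact Finset.sum_le_sum fun i _ => mul_le_of_le_one_right (sq_nonneg _) (hnorm i)
  rw [sub_dotProduct, dotProduct_sub, dotProduct_sub, dotProduct_comm z x] at h0
  linarith

/-- The singular value decomposition of a real matrix; left singular vectors of vanishing singular
values are taken to be zero. -/
theorem exists_singularValueDecomposition {n₁ n₂ : ℕ} (X : Matrix (Fin n₁) (Fin n₂) ℝ) :
    ∃ (u : Fin n₂ → Fin n₁ → ℝ) (v : Fin n₂ → Fin n₂ → ℝ) (s : Fin n₂ → ℝ),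
      (∀ i, 0 ≤ s i) ∧ (∀ i j, v i ⬝ᵥ v j = if i = j then 1 else 0) ∧
      (∀ i j, i ≠ j → u i ⬝ᵥ u j = 0) ∧ (∀ i, s i ≠ 0 → u i ⬝ᵥ u i = 1) ∧
      (∀ i, u i = (s i)⁻¹ • X *ᵥ v i) ∧ (X = ∑ i, s i • vecMulVec (u i) (v i)) ∧
      nuclearNorm X = ∑ i, s i := by
  set T := Matrix.toEuclideanLin X with hT
  have hfin : Module.finrank ℝ (EuclideanSpace ℝ (Fin n₂)) = n₂ := by simp
  -- The right singular vectors are an eigenbasis of `Tᵀ T`; their images under `T` are orthogonal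
  -- with squared lengths `s i ^ 2`.
  set b := T.isSymmetric_adjoint_comp_self.eigenvectorBasis hfin with hb
  set s : Fin n₂ → ℝ := fun i => T.singularValues i with hs
  have hinner : ∀ i j, inner ℝ (T (b i)) (T (b j)) = if i = j then s i ^ 2 else 0 := by
    intro i j
    rw [← LinearMap.adjoint_inner_left, ← LinearMap.comp_apply,
      T.isSymmetric_adjoint_comp_self.apply_eigenvectorBasis hfin, ← hb]
    change inner ℝ ((T.isSymmetric_adjoint_comp_self.eigenvalues hfin i) • b i) (b j) = _
    rw [real_inner_smul_left, ← T.sq_singularValues_fin hfin]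
    have := orthonormal_iff_ite.mp b.orthonormal i j
    rw [this]
    split_ifs <;> simp [hs]
  have hTb : ∀ i, (T (b i)).ofLp = X *ᵥ (b i).ofLp := fun i => by rw [hT, toLpLin_apply]
  have hdotX : ∀ i j, (X *ᵥ (b i).ofLp) ⬝ᵥ (X *ᵥ (b j).ofLp) = if i = j then s i ^ 2 else 0 := by
    intro i j
    rw [← hinner, EuclideanSpace.inner_eq_star_dotProduct, hTb, hTb, dotProduct_comm]
    simp
  have hzero : ∀ i, s i = 0 → X *ᵥ (b i).ofLp = 0 := by
    intro i hi
    have := hdotX i i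
    rw [if_pos rfl, hi, sq, zero_mul] at this
    exact dotProduct_self_eq_zero.mp this
  -- Since `0⁻¹ = 0`, the left vector of a vanishing singular value is zero.
  refine ⟨fun i => (s i)⁻¹ • X *ᵥ (b i).ofLp, fun i => (b i).ofLp, s,
    fun i => T.singularValues_nonneg i, ?_, ?_, ?_, fun i => rfl, ?_, ?_⟩
  · intro i j
    have := orthonormal_iff_ite.mp b.orthonormal i j
    rw [← this, EuclideanSpace.inner_eq_star_dotProduct, dotProduct_comm]
    simp
  · intro i j hij
    rw [smul_dotProduct, dotProduct_smul, hdotX, if_neg hij]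
    simp
  · intro i hi
    rw [smul_dotProduct, dotProduct_smul, hdotX, if_pos rfl]
    simp only [smul_eq_mul]
    field_simp
  · have hterm : ∀ i, s i • vecMulVec ((s i)⁻¹ • X *ᵥ (b i).ofLp) (b i).ofLp
        = vecMulVec (X *ᵥ (b i).ofLp) (b i).ofLp := by
      intro i
      by_cases hi : s i = 0
      · rw [hzero i hi]; simp
      · rw [smul_vecMulVec, smul_smul, mul_inv_cancel₀ hi, one_smul]
    simp only [hterm]
    refine Matrix.ext_of_mulVec_single fun j => ?_
    rw [sum_mulVec]
    have hexp := b.sum_repr' (EuclideanSpace.single j (1 : ℝ))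
    have hexp' := congrArg (fun z => X *ᵥ z.ofLp) hexp
    simp only [WithLp.ofLp_sum, WithLp.ofLp_smul] at hexp'
    rw [mulVec_sum] at hexp'
    rw [← PiLp.ofLp_single, ← hexp']
    refine Finset.sum_congr rfl fun i _ => ?_
    rw [vecMulVec_mulVec, mulVec_smul, EuclideanSpace.inner_eq_star_dotProduct, dotProduct_comm]
    simp
  -- The decomposition has `n₂` terms but the norm sums `min n₁ n₂` of them; the rank bound makes
  -- the others vanish.
  · have hrange : ∀ k, min n₁ n₂ ≤ k → T.singularValues k = 0 := by
      intro k hk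
      rw [LinearMap.singularValues_eq_zero_iff_le_finrank_range]
      refine le_trans (le_min ?_ ?_) hk
      · simpa using Submodule.finrank_le (LinearMap.range T)
      · simpa using LinearMap.finrank_range_le T
    rw [nuclearNorm, ← Fin.sum_univ_eq_sum_range (fun k => T.singularValues k),
      hs, Fin.sum_univ_eq_sum_range (fun k => T.singularValues k),
      Fin.sum_univ_eq_sum_range (fun k => T.singularValues k)]
    refine Finset.sum_subset (Finset.range_mono (min_le_right _ _)) fun k _ hk => ?_
    exact hrange k (not_lt.mp fun h => hk (Finset.mem_range.mpr h))

variable {n₁ n₂ : ℕ}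

theorem nuclearNorm_nonneg (X : Matrix (Fin n₁) (Fin n₂) ℝ) : 0 ≤ nuclearNorm X :=
  Finset.sum_nonneg fun _ _ => LinearMap.singularValues_nonneg _ _

/-- Each rank-one term of the singular value decomposition of `X` pairs with `Y` to at most `c`
times its singular value. -/
theorem frobInner_le_mul_nuclearNorm {Y : Matrix (Fin n₁) (Fin n₂) ℝ} {c : ℝ}
    (hY : SpectralLe Y c) (X : Matrix (Fin n₁) (Fin n₂) ℝ) :
    frobInner Y X ≤ c * nuclearNorm X := by
  obtain ⟨u, v, s, hs, hv, hu, hu1, -, hX, hnuc⟩ := exists_singularValueDecomposition X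
  rw [hnuc, hX, frobInner_sum_right, Finset.mul_sum]
  refine Finset.sum_le_sum fun i _ => ?_
  rw [frobInner_smul_right, frobInner_vecMulVec]
  by_cases hi : s i = 0
  · simp [hi]
  · have h := hY (u i) (v i)
    rw [hu1 i hi, hv, if_pos rfl] at h
    rw [mul_comm c]
    exact mul_le_mul_of_nonneg_left (by linarith) (hs i)

theorem spectralLe_nuclearNorm (X : Matrix (Fin n₁) (Fin n₂) ℝ) :
    SpectralLe X (nuclearNorm X) := by
  obtain ⟨u, v, s, hs, hv, hu, hu1, hu2, hX, hnuc⟩ := exists_singularValueDecomposition X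
  intro x y
  have hule : ∀ i, u i ⬝ᵥ u i ≤ 1 := by
    intro i
    by_cases hi : s i = 0
    · rw [hu2, hi]; simp
    · rw [hu1 i hi]
  have hx := sum_dotProduct_sq_le u hu hule x
  have hy := sum_dotProduct_sq_le v (fun i j h => by rw [hv, if_neg h])
    (fun i => by rw [hv, if_pos rfl]) y
  rw [hnuc, Finset.sum_mul]
  conv_lhs => rw [hX, sum_mulVec, dotProduct_sum, Finset.mul_sum]
  refine Finset.sum_le_sum fun i _ => ?_
  rw [smul_mulVec, dotProduct_smul, smul_eq_mul, vecMulVec_mulVec]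
  have h1 : (x ⬝ᵥ u i) ^ 2 ≤ x ⬝ᵥ x :=
    (Finset.single_le_sum (f := fun i => (x ⬝ᵥ u i) ^ 2) (fun j _ => sq_nonneg _)
      (Finset.mem_univ i)).trans hx
  have h2 : (y ⬝ᵥ v i) ^ 2 ≤ y ⬝ᵥ y :=
    (Finset.single_le_sum (f := fun i => (y ⬝ᵥ v i) ^ 2) (fun j _ => sq_nonneg _)
      (Finset.mem_univ i)).trans hy
  have h3 : x ⬝ᵥ (MulOpposite.op (v i ⬝ᵥ y) • u i) = (x ⬝ᵥ u i) * (y ⬝ᵥ v i) := by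
    rw [dotProduct_comm y]; simp only [dotProduct_smul, MulOpposite.smul_eq_mul_unop, MulOpposite.unop_op]
  rw [h3]
  have h4 : 2 * ((x ⬝ᵥ u i) * (y ⬝ᵥ v i)) ≤ x ⬝ᵥ x + y ⬝ᵥ y := by
    nlinarith [sq_nonneg (x ⬝ᵥ u i - y ⬝ᵥ v i)]
  nlinarith [mul_le_mul_of_nonneg_left h4 (hs i)]

theorem frobInner_self_le_nuclearNorm_sq (X : Matrix (Fin n₁) (Fin n₂) ℝ) :
    frobInner X X ≤ nuclearNorm X ^ 2 := by
  rw [sq]; exact frobInner_le_mul_nuclearNorm (spectralLe_nuclearNorm X) X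

/-- The nuclear norm is attained by a partial isometry with the same kernel and range. -/
theorem exists_spectralLe_one_frobInner_eq (X : Matrix (Fin n₁) (Fin n₂) ℝ) :
    ∃ Q : Matrix (Fin n₁) (Fin n₂) ℝ, SpectralLe Q 1 ∧ frobInner Q X = nuclearNorm X ∧
      (∀ A : Matrix (Fin n₁) (Fin n₁) ℝ, A * X = 0 → A * Q = 0) ∧
      (∀ B : Matrix (Fin n₂) (Fin n₂) ℝ, X * B = 0 → Q * B = 0) := by
  obtain ⟨u, v, s, hs, hv, hu, hu1, hu2, hX, hnuc⟩ := exists_singularValueDecomposition X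
  have hule : ∀ i, u i ⬝ᵥ u i ≤ 1 := by
    intro i
    by_cases hi : s i = 0
    · rw [hu2, hi]; simp
    · rw [hu1 i hi]
  have hQ : ∀ x y, x ⬝ᵥ (∑ i, vecMulVec (u i) (v i)) *ᵥ y = ∑ i, (x ⬝ᵥ u i) * (y ⬝ᵥ v i) := by
    intro x y
    rw [sum_mulVec, dotProduct_sum]
    refine Finset.sum_congr rfl fun i _ => ?_
    rw [vecMulVec_mulVec, dotProduct_comm y]
    simp [dotProduct_smul, mul_comm]
  -- The polar factor of `X`. A left annihilator of `X` kills every `u i`, a scaled image under `X`;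
  -- a right annihilator kills each `v i` with `s i ≠ 0`, which lies in the row space.
  refine ⟨∑ i, vecMulVec (u i) (v i), ?_, ?_, ?_, ?_⟩
  · intro x y
    have hx := sum_dotProduct_sq_le u hu hule x
    have hy := sum_dotProduct_sq_le v (fun i j h => by rw [hv, if_neg h])
      (fun i => by rw [hv, if_pos rfl]) y
    rw [hQ, one_mul, Finset.mul_sum]
    refine le_trans ?_ (add_le_add hx hy)
    rw [← Finset.sum_add_distrib]
    refine Finset.sum_le_sum fun i _ => ?_
    nlinarith [sq_nonneg (x ⬝ᵥ u i - y ⬝ᵥ v i)]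
  · rw [hnuc]
    conv_lhs => rw [hX, frobInner_sum_right]
    refine Finset.sum_congr rfl fun j _ => ?_
    rw [frobInner_smul_right, frobInner_vecMulVec, hQ, Finset.sum_eq_single j]
    · by_cases hj : s j = 0
      · simp [hj]
      · rw [hu1 j hj, hv, if_pos rfl]; ring
    · intro i _ hij
      rw [hu j i hij.symm, zero_mul]
    · simp
  · intro A hA
    rw [Matrix.mul_sum]
    refine Finset.sum_eq_zero fun i _ => ?_
    rw [mul_vecMulVec, hu2, mulVec_smul, mulVec_mulVec, hA]
    simp
  · intro B hB
    rw [Matrix.sum_mul]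
    refine Finset.sum_eq_zero fun i _ => ?_
    by_cases hi : s i = 0
    · rw [hu2, hi]; simp
    · have h1 : u i ᵥ* X = s i • v i := by
        conv_lhs => rw [hX]
        rw [vecMul_sum, Finset.sum_eq_single i]
        · rw [vecMul_smul, vecMul_vecMulVec, hu1 i hi, one_smul]
        · intro j _ hj
          rw [vecMul_smul, vecMul_vecMulVec, hu i j hj.symm, zero_smul, smul_zero]
        · simp
      have h2 : s i • (v i ᵥ* B) = 0 := by
        rw [← smul_vecMul, ← h1, vecMul_vecMul, hB, vecMul_zero]
      have h3 : v i ᵥ* B = 0 := (smul_eq_zero.mp h2).resolve_left hi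
      rw [vecMulVec_mul, h3]
      ext a b
      simp [vecMulVec_apply]

variable {r : ℕ} {M : Matrix (Fin n₁) (Fin n₂) ℝ} {U : Matrix (Fin n₁) (Fin r) ℝ} {σ : Fin r → ℝ}
  {V : Matrix (Fin n₂) (Fin r) ℝ}

theorem IsThinSVD.frobInner_eq (h : IsThinSVD M U σ V) (Y : Matrix (Fin n₁) (Fin n₂) ℝ) :
    frobInner Y M = ∑ k, σ k * (U.col k ⬝ᵥ Y *ᵥ V.col k) := by
  have : M = ∑ k, σ k • vecMulVec (U.col k) (V.col k) := by
    ext i j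
    rw [h.eq, mul_apply, Matrix.sum_apply]
    refine Finset.sum_congr rfl fun k _ => ?_
    simp only [mul_diagonal, transpose_apply, Matrix.smul_apply, vecMulVec_apply, col_apply, smul_eq_mul]
    ring
  rw [this, frobInner_sum_right]
  exact Finset.sum_congr rfl fun k _ => by rw [frobInner_smul_right, frobInner_vecMulVec]

theorem col_dotProduct_col {n : Type*} [Fintype n] {r : ℕ} {U : Matrix n (Fin r) ℝ} (h : Uᵀ * U = 1)
    (k l : Fin r) : U.col k ⬝ᵥ U.col l = if k = l then 1 else 0 := by
  have := congrFun (congrFun h k) l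
  rw [one_apply] at this
  rw [← this, mul_apply]
  rfl

theorem IsThinSVD.nuclearNorm_le (h : IsThinSVD M U σ V) : nuclearNorm M ≤ ∑ k, σ k := by
  obtain ⟨Q, hQ, hQM, -, -⟩ := exists_spectralLe_one_frobInner_eq M
  rw [← hQM, h.frobInner_eq]
  refine Finset.sum_le_sum fun k _ => mul_le_of_le_one_right (h.pos k).le ?_
  have := hQ (U.col k) (V.col k)
  rw [col_dotProduct_col h.orthonormal_left, col_dotProduct_col h.orthonormal_right,
    if_pos rfl] at this
  linarith

theorem IsThinSVD.frobInner_mul_transpose (h : IsThinSVD M U σ V) :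
    frobInner (U * Vᵀ) M = ∑ k, σ k := by
  rw [frobInner_eq_trace, h.eq, transpose_mul, transpose_transpose]
  calc (V * Uᵀ * (U * diagonal σ * Vᵀ)).trace
      = (V * ((Uᵀ * U) * diagonal σ * Vᵀ)).trace := by simp only [Matrix.mul_assoc]
    _ = (diagonal σ * (Vᵀ * V)).trace := by
        rw [h.orthonormal_left, Matrix.one_mul, trace_mul_comm, Matrix.mul_assoc]
    _ = _ := by rw [h.orthonormal_right, Matrix.mul_one, trace_diagonal]

end NuclearNorm

/-! ### Coherence as a bound on projection diagonals. -/

section Coherence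

/-- The factorizations `hA` and `hB` say that `M` and `U` have the same column space, so `U * Uᵀ` is
its orthogonal projection and the diagonal entries are the squared norms in the coherence. -/
theorem diag_mul_transpose_le_of_coherence_le {n k r : ℕ} {M : Matrix (Fin n) (Fin k) ℝ}
    {U : Matrix (Fin n) (Fin r) ℝ} {A : Matrix (Fin k) (Fin r) ℝ} {B : Matrix (Fin r) (Fin k) ℝ}
    (hU : Uᵀ * U = 1) (hA : M * A = U) (hB : M = U * B) (hr : 0 < r) (hrank : M.rank = r) {μ : ℝ}
    (hμ : coherence (colSpace M) ≤ μ) (i : Fin n) : (U * Uᵀ) i i ≤ μ * r / n := by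
  have hdim : Module.finrank ℝ (colSpace M) = r := by
    rw [← hrank, colSpace, toEuclideanLin_eq_toLin_orthonormal, ← rank_eq_finrank_range_toLin]
  have hproj : (colSpace M).starProjection (EuclideanSpace.single i (1 : ℝ))
      = WithLp.toLp 2 ((U * Uᵀ) *ᵥ Pi.single i 1) := by
    refine Submodule.eq_starProjection_of_mem_of_inner_eq_zero ?_ ?_
    · refine ⟨WithLp.toLp 2 (A *ᵥ Uᵀ *ᵥ Pi.single i 1), ?_⟩
      rw [toLpLin_apply, mulVec_mulVec, mulVec_mulVec, hA]
    · rintro w ⟨y, rfl⟩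
      rw [toLpLin_apply, EuclideanSpace.inner_eq_star_dotProduct]
      simp only [star_trivial, WithLp.ofLp_sub, PiLp.ofLp_single]
      rw [hB, dotProduct_sub, dotProduct_comm, dotProduct_comm _ ((U * Uᵀ) *ᵥ Pi.single i 1)]
      rw [sub_eq_zero, dotProduct_mulVec, dotProduct_mulVec, ← mulVec_transpose,
        ← mulVec_transpose, transpose_mul, mulVec_mulVec, ← Matrix.mul_assoc, Matrix.mul_assoc Bᵀ,
        hU, Matrix.mul_one]
  have hnorm : ‖(colSpace M).starProjection (EuclideanSpace.single i (1 : ℝ))‖ ^ 2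
      = (U * Uᵀ) i i := by
    rw [hproj, EuclideanSpace.real_norm_sq_eq]
    have h1 : ∀ j, ((U * Uᵀ) *ᵥ Pi.single i 1) j = (U * Uᵀ) j i := fun j => by simp
    simp only [h1]
    have h2 : (U * Uᵀ) * (U * Uᵀ) = U * Uᵀ := by
      rw [Matrix.mul_assoc, ← Matrix.mul_assoc Uᵀ, hU, Matrix.one_mul]
    have h3 : (U * Uᵀ)ᵀ = U * Uᵀ := by simp
    conv_rhs => rw [← h2, mul_apply]
    refine Finset.sum_congr rfl fun j _ => ?_
    have : (U * Uᵀ) i j = (U * Uᵀ) j i := by conv_lhs => rw [← h3, transpose_apply]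
    rw [this, sq]
  have hn : (0 : ℝ) < n := by exact_mod_cast i.pos
  have hr' : (0 : ℝ) < r := by exact_mod_cast hr
  have hle : (U * Uᵀ) i i ≤ ⨆ j : Fin n,
      ‖(colSpace M).starProjection (EuclideanSpace.single j (1 : ℝ))‖ ^ 2 := by
    rw [← hnorm]
    exact le_ciSup (f := fun j : Fin n =>
      ‖(colSpace M).starProjection (EuclideanSpace.single j (1 : ℝ))‖ ^ 2)
      (Set.finite_range _).bddAbove i
  rw [coherence, hdim] at hμ
  rw [le_div_iff₀ hn]
  have := mul_le_mul_of_nonneg_left hle (show 0 ≤ (n : ℝ) / r by positivity)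
  have h4 := this.trans hμ
  rw [div_mul_eq_mul_div, div_le_iff₀ hr'] at h4
  linarith

variable {n₁ n₂ r : ℕ} {M : Matrix (Fin n₁) (Fin n₂) ℝ} {U : Matrix (Fin n₁) (Fin r) ℝ}
  {σ : Fin r → ℝ} {V : Matrix (Fin n₂) (Fin r) ℝ}

theorem IsThinSVD.transpose (h : IsThinSVD M U σ V) : IsThinSVD Mᵀ V σ U := by
  refine ⟨h.orthonormal_right, h.orthonormal_left, h.pos, ?_⟩
  conv_lhs => rw [h.eq]
  simp [Matrix.mul_assoc]

theorem IsThinSVD.diag_left_le (h : IsThinSVD M U σ V) (hr : 0 < r) (hrank : M.rank = r) {μ : ℝ}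
    (hμ : coherence (colSpace M) ≤ μ) (i : Fin n₁) : (U * Uᵀ) i i ≤ μ * r / n₁ := by
  refine diag_mul_transpose_le_of_coherence_le (A := V * diagonal fun k => (σ k)⁻¹)
    (B := diagonal σ * Vᵀ) h.orthonormal_left ?_ ?_ hr hrank hμ i
  · conv_lhs => rw [h.eq]
    calc U * diagonal σ * Vᵀ * (V * diagonal fun k => (σ k)⁻¹)
        = U * (diagonal σ * (Vᵀ * V) * diagonal fun k => (σ k)⁻¹) := by
          simp only [Matrix.mul_assoc]
      _ = U := by
          rw [h.orthonormal_right, Matrix.mul_one, diagonal_mul_diagonal]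
          simp [fun k => mul_inv_cancel₀ (h.pos k).ne']
  · rw [← Matrix.mul_assoc]; exact h.eq

theorem IsThinSVD.diag_right_le (h : IsThinSVD M U σ V) (hr : 0 < r) (hrank : M.rank = r) {μ : ℝ}
    (hμ : coherence (rowSpace M) ≤ μ) (i : Fin n₂) : (V * Vᵀ) i i ≤ μ * r / n₂ :=
  h.transpose.diag_left_le hr (by rw [rank_transpose, hrank]) hμ i

end Coherence

/-! ### The tangent space and its projection. -/

section TangentSpace

variable {m n : Type*} [Fintype m] [Fintype n] {P : Matrix m m ℝ} {Q : Matrix n n ℝ}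

/-- `P` is the matrix of an orthogonal projection. -/
def IsOrthProj (P : Matrix m m ℝ) : Prop := Pᵀ = P ∧ P * P = P

theorem isOrthProj_mul_transpose {r : ℕ} {U : Matrix m (Fin r) ℝ} (h : Uᵀ * U = 1) :
    IsOrthProj (U * Uᵀ) :=
  ⟨by simp, by rw [Matrix.mul_assoc, ← Matrix.mul_assoc Uᵀ, h, Matrix.one_mul]⟩

theorem IsOrthProj.apply_comm {P : Matrix m m ℝ} (hP : IsOrthProj P) (i j : m) : P i j = P j i := by
  conv_lhs => rw [← hP.1, transpose_apply]

theorem IsOrthProj.diag_nonneg {P : Matrix m m ℝ} (hP : IsOrthProj P) (i : m) : 0 ≤ P i i := by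
  rw [← hP.2, mul_apply]
  exact Finset.sum_nonneg fun k _ => by rw [hP.apply_comm i k]; exact mul_self_nonneg _

theorem IsOrthProj.dotProduct_mulVec {P : Matrix m m ℝ} (hP : IsOrthProj P) (x y : m → ℝ) :
    (P *ᵥ x) ⬝ᵥ y = x ⬝ᵥ P *ᵥ y := by
  rw [Matrix.dotProduct_mulVec, ← mulVec_transpose, hP.1]

theorem IsOrthProj.dotProduct_mulVec_self {P : Matrix m m ℝ} (hP : IsOrthProj P) (x : m → ℝ) :
    (P *ᵥ x) ⬝ᵥ (P *ᵥ x) = x ⬝ᵥ P *ᵥ x := by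
  rw [hP.dotProduct_mulVec, mulVec_mulVec, hP.2]

/-- The orthogonal projection onto the space of matrices `P A + B Q`. -/
def tanProj (P : Matrix m m ℝ) (Q : Matrix n n ℝ) : Matrix m n ℝ →ₗ[ℝ] Matrix m n ℝ where
  toFun Z := P * Z + Z * Q - P * Z * Q
  map_add' A B := by simp only [Matrix.mul_add, Matrix.add_mul]; abel
  map_smul' c A := by
    simp only [Matrix.mul_smul, Matrix.smul_mul, RingHom.id_apply, smul_add, smul_sub]

theorem tanProj_apply (P : Matrix m m ℝ) (Q : Matrix n n ℝ) (Z : Matrix m n ℝ) :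
    tanProj P Q Z = P * Z + Z * Q - P * Z * Q := rfl

theorem tanProj_tanProj (hP : IsOrthProj P) (hQ : IsOrthProj Q) (Z : Matrix m n ℝ) :
    tanProj P Q (tanProj P Q Z) = tanProj P Q Z := by
  have h1 : ∀ A : Matrix m n ℝ, P * (P * A) = P * A := fun A => by rw [← Matrix.mul_assoc, hP.2]
  have h2 : ∀ A : Matrix m n ℝ, A * Q * Q = A * Q := fun A => by rw [Matrix.mul_assoc, hQ.2]
  simp only [tanProj_apply, Matrix.mul_sub, Matrix.sub_mul, Matrix.mul_add, Matrix.add_mul,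
    Matrix.mul_assoc, h1, hQ.2]
  abel

theorem frobInner_mul_left (A : Matrix m m ℝ) (X Y : Matrix m n ℝ) :
    frobInner (A * X) Y = frobInner X (Aᵀ * Y) := by
  rw [frobInner_eq_trace, frobInner_eq_trace, transpose_mul, Matrix.mul_assoc]

theorem frobInner_mul_right (B : Matrix n n ℝ) (X Y : Matrix m n ℝ) :
    frobInner (X * B) Y = frobInner X (Y * Bᵀ) := by
  rw [frobInner_eq_trace, frobInner_eq_trace, transpose_mul, Matrix.mul_assoc, trace_mul_comm,
    Matrix.mul_assoc]

theorem frobInner_sub_right (A B C : Matrix m n ℝ) :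
    frobInner A (B - C) = frobInner A B - frobInner A C := by
  rw [frobInner_comm, frobInner_sub_left, frobInner_comm, frobInner_comm C]

theorem frobInner_tanProj_left (hP : IsOrthProj P) (hQ : IsOrthProj Q) (A B : Matrix m n ℝ) :
    frobInner (tanProj P Q A) B = frobInner A (tanProj P Q B) := by
  simp only [tanProj_apply, frobInner_sub_left, frobInner_add_left, frobInner_sub_right,
    frobInner_add_right, frobInner_mul_left, frobInner_mul_right, hP.1, hQ.1, Matrix.mul_assoc]

theorem frobInner_tanProj_self_le (hP : IsOrthProj P) (hQ : IsOrthProj Q) (A : Matrix m n ℝ) :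
    frobInner (tanProj P Q A) (tanProj P Q A) ≤ frobInner A A := by
  have h := frobInner_self_nonneg (A - tanProj P Q A)
  have h1 : frobInner (tanProj P Q A) (tanProj P Q A) = frobInner (tanProj P Q A) A := by
    rw [frobInner_comm, frobInner_tanProj_left hP hQ, tanProj_tanProj hP hQ, frobInner_comm]
  rw [frobInner_sub_left, frobInner_sub_right, frobInner_sub_right, h1,
    frobInner_comm A (tanProj P Q A)] at h
  rw [h1]
  linarith

variable [DecidableEq m] [DecidableEq n]

theorem IsOrthProj.one_sub {P : Matrix m m ℝ} (hP : IsOrthProj P) : IsOrthProj (1 - P) :=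
  ⟨by rw [transpose_sub, transpose_one, hP.1], by
    simp [sub_mul, mul_sub, hP.2]⟩

theorem IsOrthProj.dotProduct_add {P : Matrix m m ℝ} (hP : IsOrthProj P) (x : m → ℝ) :
    (P *ᵥ x) ⬝ᵥ (P *ᵥ x) + ((1 - P) *ᵥ x) ⬝ᵥ ((1 - P) *ᵥ x) = x ⬝ᵥ x := by
  rw [hP.dotProduct_mulVec_self, hP.one_sub.dotProduct_mulVec_self, sub_mulVec, dotProduct_sub,
    one_mulVec]
  ring

theorem SpectralLe.mul_mul {P : Matrix m m ℝ} {Q : Matrix n n ℝ} (hP : IsOrthProj P)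
    (hQ : IsOrthProj Q) {Y : Matrix m n ℝ} {c : ℝ} (hc : 0 ≤ c) (hY : SpectralLe Y c) :
    SpectralLe (P * Y * Q) c := by
  intro x y
  have h := hY (P *ᵥ x) (Q *ᵥ y)
  rw [hP.dotProduct_mulVec, mulVec_mulVec, mulVec_mulVec] at h
  refine h.trans (mul_le_mul_of_nonneg_left ?_ hc)
  have h1 := hP.dotProduct_add x
  have h2 := hQ.dotProduct_add y
  have h3 := dotProduct_self_nonneg' ((1 - P) *ᵥ x)
  have h4 := dotProduct_self_nonneg' ((1 - Q) *ᵥ y)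
  linarith

theorem sub_tanProj (P : Matrix m m ℝ) (Q : Matrix n n ℝ) (Z : Matrix m n ℝ) :
    Z - tanProj P Q Z = (1 - P) * Z * (1 - Q) := by
  rw [tanProj_apply]
  simp only [Matrix.mul_sub, Matrix.sub_mul, Matrix.one_mul, Matrix.mul_one]
  abel

theorem frobInner_single_left (i : m) (j : n) (A : Matrix m n ℝ) :
    frobInner (Matrix.single i j 1) A = A i j := by
  rw [frobInner, Finset.sum_eq_single i, Finset.sum_eq_single j]
  · simp
  · intro b _ hb; simp [hb.symm]
  · simp
  · intro b _ hb
    exact Finset.sum_eq_zero fun c _ => by simp [hb.symm]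
  · simp

theorem frobInner_tanProj_single (hP : IsOrthProj P) (hQ : IsOrthProj Q) (i : m) (j : n)
    (A : Matrix m n ℝ) :
    frobInner (tanProj P Q (Matrix.single i j 1)) A = tanProj P Q A i j := by
  rw [frobInner_tanProj_left hP hQ, frobInner_single_left]

/-- The left side is exactly `P i i + Q j j - P i i * Q j j`. Multiplied by `n₁ * n₂`, the right
side is what the parameter `N` bounds in the deviation inequalities. -/
theorem frobInner_tanProj_single_self_le (hP : IsOrthProj P) (hQ : IsOrthProj Q) (i : m) (j : n) :
    frobInner (tanProj P Q (Matrix.single i j 1)) (tanProj P Q (Matrix.single i j 1))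
      ≤ P i i + Q j j := by
  rw [frobInner_tanProj_single hP hQ, tanProj_tanProj hP hQ, tanProj_apply, Matrix.sub_apply, Matrix.add_apply,
    Matrix.mul_assoc]
  have h1 : (P * Matrix.single i j (1 : ℝ)) i j = P i i := by simp
  have h2 : (Matrix.single i j (1 : ℝ) * Q) i j = Q j j := by simp
  have h3 : (P * (Matrix.single i j (1 : ℝ) * Q)) i j = P i i * Q j j := by
    rw [mul_apply, Finset.sum_eq_single i]
    · rw [h2]
    · intro k _ hk
      rw [Matrix.single_mul_apply_of_ne _ _ _ _ _ hk, mul_zero]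
    · simp
  rw [h1, h2, h3]
  have := mul_nonneg (hP.diag_nonneg i) (hQ.diag_nonneg j)
  linarith

end TangentSpace

/-! ### Deviation bounds on the tangent space. -/

section Deviations

variable {κ : Type*} [Fintype κ] [DecidableEq κ]

theorem freq_sum_gt_le {ι : Type*} [Fintype ι] (x : ι → ℝ) (hsum : ∑ a, x a = 0) {R s θ t : ℝ}
    (hR : ∀ a, |x a| ≤ R) (hs : ∑ a, x a ^ 2 ≤ Fintype.card ι * s) (hs0 : 0 ≤ s) (hθ : 0 < θ)
    (hθR : θ * R ≤ 1) :
    freq (fun w : κ → ι => t < ∑ k, x (w k))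
      ≤ Real.exp (-(θ * t) + Fintype.card κ * (3 / 4 * θ ^ 2 * s)) := by
  have hq : ∀ a (v : Unit → ℝ), v ⬝ᵥ (Matrix.of fun _ _ : Unit => x a) *ᵥ v = x a * v () ^ 2 := by
    intro a v
    simp [dotProduct, mulVec]; ring
  have hv : ∀ v : Unit → ℝ, v ⬝ᵥ v = v () ^ 2 := fun v => by simp [dotProduct, sq]
  have h := freq_exists_quadraticForm_gt_le (κ := κ) (R := R) (s := s) (θ := θ) (t := t)
    (fun a => Matrix.of fun _ _ : Unit => x a) (fun a => rfl) (fun v => ?_) (fun a v => ?_)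
    (fun v => ?_) hs0 hθ hθR
  · rw [Fintype.card_unit, Nat.cast_one, one_mul] at h
    refine (freq_mono fun w hw => ⟨fun _ => 1, ?_⟩).trans h
    simp only [hq, hv]
    simpa using hw
  · simp only [hq]
    rw [← Finset.sum_mul, hsum, zero_mul]
  · rw [hq, hv, abs_mul, abs_of_nonneg (sq_nonneg (v ()))]
    exact mul_le_mul_of_nonneg_right (hR a) (sq_nonneg _)
  · have : ∀ a, ((Matrix.of fun _ _ : Unit => x a) *ᵥ v) ⬝ᵥ ((Matrix.of fun _ _ : Unit => x a) *ᵥ v)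
        = x a ^ 2 * v () ^ 2 := by
      intro a
      simp [dotProduct, mulVec]; ring
    simp only [this, hv]
    rw [← Finset.sum_mul]
    exact mul_le_mul_of_nonneg_right hs (sq_nonneg _)

theorem sum_sub_mean_sq_le {ι : Type*} [Fintype ι] {f : ι → ℝ} {c : ℝ}
    (h : ∑ a, f a = Fintype.card ι * c) : ∑ a, (f a - c) ^ 2 ≤ ∑ a, f a ^ 2 := by
  have : ∑ a, (f a - c) ^ 2 = ∑ a, f a ^ 2 - Fintype.card ι * c ^ 2 := by
    simp only [sub_sq, Finset.sum_add_distrib, Finset.sum_sub_distrib]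
    have h2 : ∑ a, 2 * f a * c = 2 * (Fintype.card ι * c) * c := by
      rw [← h, Finset.mul_sum, Finset.sum_mul]
    rw [h2, Finset.sum_const, Finset.card_univ, nsmul_eq_mul]
    ring
  rw [this]
  exact sub_le_self _ (by positivity)

variable {n₁ n₂ : ℕ}

/-- The sum of the sampled entries of `Z`, placed at their positions. -/
def sampleOp (w : κ → Fin n₁ × Fin n₂) (Z : Matrix (Fin n₁) (Fin n₂) ℝ) :
    Matrix (Fin n₁) (Fin n₂) ℝ :=
  ∑ k, Z (w k).1 (w k).2 • Matrix.single (w k).1 (w k).2 1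

variable {P : Matrix (Fin n₁) (Fin n₁) ℝ} {Q : Matrix (Fin n₂) (Fin n₂) ℝ} {N : ℝ}

theorem tanProj_single_apply_comm (hP : IsOrthProj P) (hQ : IsOrthProj Q) (i a : Fin n₁)
    (j b : Fin n₂) :
    tanProj P Q (Matrix.single a b 1) i j = tanProj P Q (Matrix.single i j 1) a b := by
  rw [← frobInner_tanProj_single hP hQ, frobInner_comm, frobInner_single_left]

/-- The entry is the inner product of two projected matrix units, so Cauchy–Schwarz applies. -/
theorem abs_tanProj_single_apply_le (hP : IsOrthProj P) (hQ : IsOrthProj Q) (hN0 : 0 ≤ N)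
    (hN : ∀ i j, (n₁ * n₂ : ℝ) * (P i i + Q j j) ≤ N) (i a : Fin n₁) (j b : Fin n₂) :
    (n₁ * n₂ : ℝ) * |tanProj P Q (Matrix.single a b 1) i j| ≤ N := by
  have h1 := frobInner_sq_le (tanProj P Q (Matrix.single i j 1)) (tanProj P Q (Matrix.single a b 1))
  have h2 := frobInner_tanProj_single_self_le hP hQ i j
  have h3 := frobInner_tanProj_single_self_le hP hQ a b
  rw [frobInner_tanProj_single hP hQ, tanProj_tanProj hP hQ] at h1
  refine abs_le_of_sq_le_sq' ?_ hN0 |>.2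
  have hD : (0 : ℝ) ≤ n₁ * n₂ := by positivity
  rw [mul_pow, sq_abs]
  calc (n₁ * n₂ : ℝ) ^ 2 * tanProj P Q (Matrix.single a b 1) i j ^ 2
      ≤ (n₁ * n₂ : ℝ) ^ 2 * ((P i i + Q j j) * (P a a + Q b b)) := by
        refine mul_le_mul_of_nonneg_left (h1.trans ?_) (sq_nonneg _)
        exact mul_le_mul h2 h3 (frobInner_self_nonneg _) ((frobInner_self_nonneg _).trans h2)
    _ = ((n₁ * n₂ : ℝ) * (P i i + Q j j)) * ((n₁ * n₂ : ℝ) * (P a a + Q b b)) := by ring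
    _ ≤ N * N := mul_le_mul (hN i j) (hN a b)
        (mul_nonneg hD ((frobInner_self_nonneg _).trans h3)) hN0
    _ = N ^ 2 := (sq N).symm

/-- Here `g` stands for the kernel of the projection, which reproduces `y`. The summands are
centred, bounded by `2 N z`, with variance at most `N z ^ 2`; scalar Bernstein for both signs and a
union bound over `p` finish. -/
theorem freq_exists_abs_sum_sub_gt_le {ι : Type*} [Fintype ι] {g : ι → ι → ℝ} {y : ι → ℝ}
    {D z q : ℝ} (hD : (Fintype.card ι : ℝ) = D) (hq : (Fintype.card κ : ℝ) = q) (hN1 : 1 ≤ N)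
    (hz : 0 < z) (hy : ∀ p, |y p| ≤ z) (hgy : ∀ p, ∑ a, g p a * y a = y p)
    (hgN : ∀ p a, D * |g p a| ≤ N) (hgg : ∀ p, D * ∑ a, g p a ^ 2 ≤ N) :
    freq (fun w : κ → ι => ∃ p, q * z / 2 < |∑ k, (D * (g p (w k) * y (w k)) - y p)|)
      ≤ 2 * D * Real.exp (-(q / (12 * N))) := by
  have hD0 : 0 ≤ D := hD ▸ Nat.cast_nonneg _
  have hN0 : 0 < N := by linarith
  set E : ℝ := Real.exp (-(q / (12 * N))) with hE
  have hmean : ∀ p, ∑ a, D * (g p a * y a) = Fintype.card ι * y p := fun p => by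
    rw [← Finset.mul_sum, hgy, hD]
  have hxsum : ∀ p, ∑ a, (D * (g p a * y a) - y p) = 0 := by
    intro p
    rw [Finset.sum_sub_distrib, hmean, Finset.sum_const, Finset.card_univ, nsmul_eq_mul, sub_self]
  have hxR : ∀ p a, |D * (g p a * y a) - y p| ≤ 2 * N * z := by
    intro p a
    calc |D * (g p a * y a) - y p| ≤ |D * (g p a * y a)| + |y p| := abs_sub _ _
      _ = D * |g p a| * |y a| + |y p| := by rw [abs_mul, abs_mul, abs_of_nonneg hD0, mul_assoc]
      _ ≤ N * z + z := add_le_add (mul_le_mul (hgN p a) (hy _) (abs_nonneg _) hN0.le) (hy _)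
      _ ≤ 2 * N * z := by nlinarith
  have hxs : ∀ p, ∑ a, (D * (g p a * y a) - y p) ^ 2 ≤ Fintype.card ι * (N * z ^ 2) := by
    intro p
    refine (sum_sub_mean_sq_le (hmean p)).trans ?_
    rw [hD]
    calc ∑ a, (D * (g p a * y a)) ^ 2 ≤ ∑ a, D ^ 2 * z ^ 2 * g p a ^ 2 := by
          refine Finset.sum_le_sum fun a _ => ?_
          have h1 : y a ^ 2 ≤ z ^ 2 := sq_le_sq' (abs_le.mp (hy _)).1 (abs_le.mp (hy _)).2
          have h2 := mul_le_mul_of_nonneg_left h1 (show 0 ≤ D ^ 2 * g p a ^ 2 by positivity)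
          linarith
      _ = D * z ^ 2 * (D * ∑ a, g p a ^ 2) := by rw [← Finset.mul_sum]; ring
      _ ≤ D * z ^ 2 * N := mul_le_mul_of_nonneg_left (hgg p) (by positivity)
      _ = D * (N * z ^ 2) := by ring
  -- The choice `θ = 1 / (3 N z)` gives `-q/(6N) + q/(12N)`.
  have hexp : -((3 * N * z)⁻¹ * (q * z / 2)) + q * (3 / 4 * (3 * N * z)⁻¹ ^ 2 * (N * z ^ 2))
      = -(q / (12 * N)) := by
    field_simp; ring
  have hθ : 0 < (3 * N * z)⁻¹ := by positivity
  have hθR : (3 * N * z)⁻¹ * (2 * N * z) ≤ 1 := by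
    rw [inv_mul_le_iff₀ (by positivity)]
    nlinarith [mul_pos hN0 hz]
  have hone : ∀ p, freq (fun w : κ → ι =>
      q * z / 2 < |∑ k, (D * (g p (w k) * y (w k)) - y p)|) ≤ 2 * E := by
    intro p
    have h1 := freq_sum_gt_le (κ := κ) (t := q * z / 2) (fun a => D * (g p a * y a) - y p)
      (hxsum p) (hxR p) (hxs p) (by positivity) hθ hθR
    have h2 := freq_sum_gt_le (κ := κ) (t := q * z / 2) (fun a => -(D * (g p a * y a) - y p))
      (by rw [Finset.sum_neg_distrib, hxsum, neg_zero]) (fun a => by rw [abs_neg]; exact hxR p a)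
      (by simpa only [neg_sq] using hxs p) (by positivity) hθ hθR
    rw [hq, hexp] at h1 h2
    refine (freq_mono fun w hw => ?_).trans ((freq_or_le _ _).trans
      ((add_le_add h1 h2).trans (two_mul E).ge))
    rw [Finset.sum_neg_distrib]
    exact lt_abs.mp hw
  have hall := freq_exists_le (fun (p : ι) (w : κ → ι) =>
    q * z / 2 < |∑ k, (D * (g p (w k) * y (w k)) - y p)|) hone
  rw [hD] at hall
  linarith

/-- Sampling contracts the entries of a fixed matrix in the tangent space towards zero. -/
theorem freq_not_abs_sub_tanProj_sampleOp_le (hP : IsOrthProj P) (hQ : IsOrthProj Q) (hN1 : 1 ≤ N)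
    (hN : ∀ i j, (n₁ * n₂ : ℝ) * (P i i + Q j j) ≤ N) {Z : Matrix (Fin n₁) (Fin n₂) ℝ}
    (hZ : tanProj P Q Z = Z) {z : ℝ} (hz : 0 < z) (hZz : ∀ i j, |Z i j| ≤ z)
    (hκ : 0 < Fintype.card κ) :
    freq (fun w : κ → Fin n₁ × Fin n₂ => ¬ ∀ i j,
        |(Z - (n₁ * n₂ / Fintype.card κ : ℝ) • tanProj P Q (sampleOp w Z)) i j| ≤ z / 2)
      ≤ 2 * (n₁ * n₂) * Real.exp (-(Fintype.card κ / (12 * N))) := by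
  have hq0 : (0 : ℝ) < Fintype.card κ := Nat.cast_pos.mpr hκ
  have h := freq_exists_abs_sum_sub_gt_le (κ := κ) (ι := Fin n₁ × Fin n₂) (N := N)
    (g := fun p a => tanProj P Q (Matrix.single p.1 p.2 1) a.1 a.2) (y := fun a => Z a.1 a.2)
    (D := n₁ * n₂) (z := z) (q := Fintype.card κ) (by simp) rfl hN1 hz (fun p => hZz _ _)
    (fun p => ?_)
    (fun p a => abs_tanProj_single_apply_le hP hQ (by linarith) hN _ _ _ _) (fun p => ?_)
  · refine (freq_mono fun w hw => ?_).trans h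
    push Not at hw
    obtain ⟨i, j, hij⟩ := hw
    refine ⟨(i, j), ?_⟩
    have h1 : tanProj P Q (sampleOp w Z) i j
        = ∑ k, tanProj P Q (Matrix.single i j 1) (w k).1 (w k).2 * Z (w k).1 (w k).2 := by
      rw [sampleOp, map_sum, Matrix.sum_apply]
      refine Finset.sum_congr rfl fun k _ => ?_
      rw [map_smul, Matrix.smul_apply, smul_eq_mul, mul_comm, tanProj_single_apply_comm hP hQ]
    rw [Finset.sum_sub_distrib, ← Finset.mul_sum, Finset.sum_const, Finset.card_univ, nsmul_eq_mul,
      ← h1]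
    have h2 : (n₁ * n₂ : ℝ) * tanProj P Q (sampleOp w Z) i j - Fintype.card κ * Z i j
        = -(Fintype.card κ *
          (Z - (n₁ * n₂ / Fintype.card κ : ℝ) • tanProj P Q (sampleOp w Z)) i j) := by
      rw [Matrix.sub_apply, Matrix.smul_apply, smul_eq_mul]
      field_simp
      ring
    rw [h2, abs_neg, abs_mul, abs_of_pos hq0, mul_div_assoc]
    exact mul_lt_mul_of_pos_left hij hq0
  · have := frobInner_tanProj_single hP hQ p.1 p.2 Z
    rw [hZ, frobInner, ← Fintype.sum_prod_type'
      (f := fun i j => tanProj P Q (Matrix.single p.1 p.2 1) i j * Z i j)] at this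
    exact this
  · have h2 := frobInner_tanProj_single_self_le hP hQ p.1 p.2
    rw [frobInner, ← Fintype.sum_prod_type'
      (f := fun i j => tanProj P Q (Matrix.single p.1 p.2 1) i j
        * tanProj P Q (Matrix.single p.1 p.2 1) i j)] at h2
    simp only [sq]
    exact (mul_le_mul_of_nonneg_left h2 (by positivity)).trans (hN _ _)

/-- On the tangent space, sampling is bounded below by half of its expectation. -/
theorem freq_not_frobInner_le_sum_sq (hP : IsOrthProj P) (hQ : IsOrthProj Q) (hN1 : 1 ≤ N)
    (hN : ∀ i j, (n₁ * n₂ : ℝ) * (P i i + Q j j) ≤ N) :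
    freq (fun w : κ → Fin n₁ × Fin n₂ => ¬ ∀ Z, tanProj P Q Z = Z →
        Fintype.card κ / 2 * frobInner Z Z ≤ (n₁ * n₂ : ℝ) * ∑ k, Z (w k).1 (w k).2 ^ 2)
      ≤ n₁ * n₂ * Real.exp (-(Fintype.card κ / (12 * N))) := by
  set D : ℝ := n₁ * n₂ with hD
  set q : ℝ := ((Fintype.card κ : ℕ) : ℝ) with hq
  have hD0 : 0 ≤ D := by positivity
  have hN0 : 0 < N := by linarith
  have hcard : (Fintype.card (Fin n₁ × Fin n₂) : ℝ) = D := by simp [hD]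
  let mat : (Fin n₁ × Fin n₂ → ℝ) → Matrix (Fin n₁) (Fin n₂) ℝ := fun v =>
    Matrix.of fun i j => v (i, j)
  let g : Fin n₁ × Fin n₂ → Fin n₁ × Fin n₂ → ℝ := fun a p =>
    tanProj P Q (Matrix.single a.1 a.2 1) p.1 p.2
  have hg : ∀ a v, g a ⬝ᵥ v = tanProj P Q (mat v) a.1 a.2 := by
    intro a v
    rw [← frobInner_tanProj_single hP hQ, frobInner, ← Fintype.sum_prod_type'
      (f := fun i j => tanProj P Q (Matrix.single a.1 a.2 1) i j * mat v i j)]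
    rfl
  have hvv : ∀ v, v ⬝ᵥ v = frobInner (mat v) (mat v) := by
    intro v
    rw [frobInner, ← Fintype.sum_prod_type' (f := fun i j => mat v i j * mat v i j)]
    rfl
  have hsymm : ∀ p a, g a p = g p a :=
    fun p a => tanProj_single_apply_comm hP hQ _ _ _ _
  -- On vectorized matrices `X a` is the tangent projection minus `D` times the rank-one form of `g
  -- a`. These sum to zero, because the rank-one forms sum to the projection.
  let X : Fin n₁ × Fin n₂ → Matrix (Fin n₁ × Fin n₂) (Fin n₁ × Fin n₂) ℝ := fun a =>
    Matrix.of fun p b => g p b - D * (g a p * g a b)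
  have hXv : ∀ a v, X a *ᵥ v = fun p => g p ⬝ᵥ v - D * (g a p * (g a ⬝ᵥ v)) := by
    intro a v
    ext p
    simp only [X, mulVec, dotProduct, Matrix.of_apply, sub_mul, Finset.sum_sub_distrib,
      Finset.mul_sum]
    congr 1
    exact Finset.sum_congr rfl fun b _ => by ring
  set T : (Fin n₁ × Fin n₂ → ℝ) → ℝ := fun v =>
    frobInner (tanProj P Q (mat v)) (tanProj P Q (mat v)) with hT
  have hTle : ∀ v, T v ≤ v ⬝ᵥ v := fun v => by rw [hvv]; exact frobInner_tanProj_self_le hP hQ _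
  have hT0 : ∀ v, 0 ≤ T v := fun v => frobInner_self_nonneg _
  have hTsum : ∀ v, ∑ a, (g a ⬝ᵥ v) ^ 2 = T v := by
    intro v
    simp only [hg, hT, frobInner, sq]
    rw [Fintype.sum_prod_type]
  have hvT : ∀ v, ∑ p, v p * (g p ⬝ᵥ v) = T v := by
    intro v
    simp only [hg, hT]
    rw [frobInner_tanProj_left hP hQ, tanProj_tanProj hP hQ, frobInner, Fintype.sum_prod_type]
    rfl
  have hquad : ∀ a v, v ⬝ᵥ X a *ᵥ v = T v - D * (g a ⬝ᵥ v) ^ 2 := by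
    intro a v
    rw [hXv, dotProduct, ← hvT]
    simp only [mul_sub, Finset.sum_sub_distrib]
    congr 1
    have : D * (g a ⬝ᵥ v) ^ 2 = D * ((∑ p, g a p * v p) * (g a ⬝ᵥ v)) := by rw [sq]; rfl
    rw [this, Finset.sum_mul, Finset.mul_sum]
    exact Finset.sum_congr rfl fun p _ => by ring
  have hgg : ∀ a, D * (g a ⬝ᵥ g a) ≤ N := by
    intro a
    have h1 : g a ⬝ᵥ g a ≤ P a.1 a.1 + Q a.2 a.2 := by
      refine le_trans (le_of_eq ?_) (frobInner_tanProj_single_self_le hP hQ a.1 a.2)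
      rw [hvv]
      rfl
    exact (mul_le_mul_of_nonneg_left h1 hD0).trans (hN _ _)
  have hga : ∀ a v, D * (g a ⬝ᵥ v) ^ 2 ≤ N * (v ⬝ᵥ v) := by
    intro a v
    have h1 : (g a ⬝ᵥ v) ^ 2 ≤ (g a ⬝ᵥ g a) * (v ⬝ᵥ v) := by
      have := Finset.sum_mul_sq_le_sq_mul_sq Finset.univ (g a) v
      simpa [dotProduct, sq] using this
    have h2 := mul_le_mul_of_nonneg_right (hgg a) (dotProduct_self_nonneg' v)
    nlinarith [mul_le_mul_of_nonneg_left h1 hD0]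
  have hB := freq_exists_quadraticForm_gt_le (κ := κ) (R := N) (s := N) (θ := (3 * N)⁻¹)
    (t := q / 2) X (fun a => ?_) (fun v => ?_) (fun a v => ?_) (fun v => ?_) hN0.le (by positivity)
    ?_
  · rw [hcard, ← hq] at hB
    have hexp : -((3 * N)⁻¹ * (q / 2)) + q * (3 / 4 * (3 * N)⁻¹ ^ 2 * N) = -(q / (12 * N)) := by
      field_simp; ring
    rw [hexp] at hB
    refine (freq_mono fun w hw => ?_).trans hB
    push Not at hw
    obtain ⟨Z, hZ, hlt⟩ := hw
    refine ⟨fun p => Z p.1 p.2, ?_⟩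
    have hmat : mat (fun p => Z p.1 p.2) = Z := rfl
    simp only [hquad, hg, hmat, hZ, hvv]
    rw [Finset.sum_sub_distrib, Finset.sum_const, Finset.card_univ, nsmul_eq_mul, ← hq,
      ← Finset.mul_sum, hT]
    simp only [hmat, hZ]
    linarith
  · ext p b
    simp only [X, transpose_apply, Matrix.of_apply]
    rw [hsymm p b]
    ring
  · simp only [hquad]
    rw [Finset.sum_sub_distrib, ← Finset.mul_sum, hTsum, Finset.sum_const, Finset.card_univ,
      nsmul_eq_mul, hcard, sub_self]
  · rw [hquad, abs_le]
    have h1 := hga a v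
    have h2 : 0 ≤ D * (g a ⬝ᵥ v) ^ 2 := by positivity
    have h3 := hTle v
    have h4 := hT0 v
    have h5 := dotProduct_self_nonneg' v
    constructor <;> nlinarith
  -- The variance is bounded coordinatewise by the second moment, which costs one factor `D * (g a
  -- ⬝ᵥ g a) ≤ N`.
  · have hcoord : ∀ p, ∑ a, (D * (g a p * (g a ⬝ᵥ v)) - g p ⬝ᵥ v) ^ 2
        ≤ ∑ a, (D * (g a p * (g a ⬝ᵥ v))) ^ 2 := by
      intro p
      refine sum_sub_mean_sq_le ?_
      rw [hcard, ← Finset.mul_sum]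
      congr 1
      have h1 : ∑ a, g a p * (g a ⬝ᵥ v) = g p ⬝ᵥ fun a => tanProj P Q (mat v) a.1 a.2 := by
        rw [dotProduct]
        exact Finset.sum_congr rfl fun a _ => by rw [hsymm, hg]
      rw [h1, hg, hg]
      have h2 : mat (fun a => tanProj P Q (mat v) a.1 a.2) = tanProj P Q (mat v) := rfl
      rw [h2, tanProj_tanProj hP hQ]
    calc ∑ a, (X a *ᵥ v) ⬝ᵥ (X a *ᵥ v)
        = ∑ p, ∑ a, (D * (g a p * (g a ⬝ᵥ v)) - g p ⬝ᵥ v) ^ 2 := by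
          rw [Finset.sum_comm]
          refine Finset.sum_congr rfl fun a _ => ?_
          rw [hXv, dotProduct]
          exact Finset.sum_congr rfl fun p _ => by ring
      _ ≤ ∑ p, ∑ a, (D * (g a p * (g a ⬝ᵥ v))) ^ 2 := Finset.sum_le_sum fun p _ => hcoord p
      _ = ∑ a, D * (g a ⬝ᵥ v) ^ 2 * (D * (g a ⬝ᵥ g a)) := by
          rw [Finset.sum_comm]
          refine Finset.sum_congr rfl fun a _ => ?_
          rw [show g a ⬝ᵥ g a = ∑ p, g a p * g a p from rfl, Finset.mul_sum, Finset.mul_sum]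
          exact Finset.sum_congr rfl fun p _ => by ring
      _ ≤ ∑ a, D * (g a ⬝ᵥ v) ^ 2 * N := Finset.sum_le_sum fun a _ =>
          mul_le_mul_of_nonneg_left (hgg a) (by positivity)
      _ = D * N * T v := by rw [← Finset.sum_mul, ← Finset.mul_sum, hTsum]; ring
      _ ≤ _ := by
          rw [hcard]
          exact mul_le_mul_of_nonneg_left (hTle v) (by positivity)
  · rw [inv_mul_le_iff₀ (by positivity)]
    linarith

end Deviations

/-! ### Spectral deviation of a sampled matrix. -/

section SpectralDeviation

/-- In each row the variance is at most the second moment, and only the samples in that row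
contribute; the rows give the factor `Fintype.card m`. -/
theorem sum_mulVec_smul_single_sub_le {m n : Type*} [Fintype m] [Fintype n] [DecidableEq m]
    [DecidableEq n] {Z : Matrix m n ℝ} {z D : ℝ} (hZ : ∀ i j, |Z i j| ≤ z)
    (hD : (Fintype.card (m × n) : ℝ) = D) (y : n → ℝ) :
    ∑ a : m × n, ((D * Z a.1 a.2) • Matrix.single a.1 a.2 1 - Z) *ᵥ y
        ⬝ᵥ ((D * Z a.1 a.2) • Matrix.single a.1 a.2 1 - Z) *ᵥ y
      ≤ D ^ 2 * z ^ 2 * Fintype.card m * (y ⬝ᵥ y) := by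
  let f : m → m × n → ℝ := fun i a => D * Z a.1 a.2 * (if a.1 = i then y a.2 else 0)
  have hcoord : ∀ (a : m × n) i,
      (((D * Z a.1 a.2) • Matrix.single a.1 a.2 (1 : ℝ) - Z) *ᵥ y) i = f i a - (Z *ᵥ y) i := by
    intro a i
    rw [sub_mulVec, smul_mulVec, Pi.sub_apply, Pi.smul_apply, smul_eq_mul]
    congr 2
    by_cases h : a.1 = i
    · simp [mulVec, dotProduct, Matrix.single_apply, h]
    · simp [mulVec, dotProduct, h]
  have hmean : ∀ i, ∑ a, f i a = Fintype.card (m × n) * (Z *ᵥ y) i := by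
    intro i
    rw [hD, Fintype.sum_prod_type, Finset.sum_eq_single i]
    · simp only [f, if_true, mulVec, dotProduct, Finset.mul_sum, mul_assoc]
    · intro k _ hk
      simp [f, hk]
    · simp
  calc ∑ a : m × n, ((D * Z a.1 a.2) • Matrix.single a.1 a.2 1 - Z) *ᵥ y
        ⬝ᵥ ((D * Z a.1 a.2) • Matrix.single a.1 a.2 1 - Z) *ᵥ y
      = ∑ i, ∑ a, (f i a - (Z *ᵥ y) i) ^ 2 := by
        rw [Finset.sum_comm]
        refine Finset.sum_congr rfl fun a _ => ?_
        rw [dotProduct]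
        exact Finset.sum_congr rfl fun i _ => by rw [hcoord, sq]
    _ ≤ ∑ i, ∑ a, f i a ^ 2 := Finset.sum_le_sum fun i _ => sum_sub_mean_sq_le (hmean i)
    _ ≤ ∑ _i : m, D ^ 2 * z ^ 2 * (y ⬝ᵥ y) := by
        refine Finset.sum_le_sum fun i _ => ?_
        rw [Fintype.sum_prod_type, Finset.sum_eq_single i]
        · simp only [f, if_true]
          rw [dotProduct, Finset.mul_sum]
          refine Finset.sum_le_sum fun j _ => ?_
          have h1 : Z i j ^ 2 ≤ z ^ 2 := sq_le_sq' (abs_le.mp (hZ _ _)).1 (abs_le.mp (hZ _ _)).2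
          have h2 := mul_le_mul_of_nonneg_left h1 (show 0 ≤ D ^ 2 * y j ^ 2 by positivity)
          linarith
        · intro k _ hk
          simp [f, hk]
        · simp
    _ = _ := by rw [Finset.sum_const, Finset.card_univ, nsmul_eq_mul]; ring

theorem two_mul_abs_dotProduct_mulVec_le {m n : Type*} [Fintype m] [Fintype n]
    {Z : Matrix m n ℝ} {z : ℝ} (hz : 0 ≤ z) (hZ : ∀ i j, |Z i j| ≤ z) (x : m → ℝ) (y : n → ℝ) :
    2 * |x ⬝ᵥ Z *ᵥ y| ≤ z * (Fintype.card n * (x ⬝ᵥ x) + Fintype.card m * (y ⬝ᵥ y)) := by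
  have h1 : |x ⬝ᵥ Z *ᵥ y| ≤ ∑ i, ∑ j, z / 2 * (x i * x i + y j * y j) := by
    simp only [dotProduct, mulVec, Finset.mul_sum]
    refine (Finset.abs_sum_le_sum_abs _ _).trans (Finset.sum_le_sum fun i _ => ?_)
    refine (Finset.abs_sum_le_sum_abs _ _).trans (Finset.sum_le_sum fun j _ => ?_)
    rw [abs_mul, abs_mul]
    have h2 := mul_le_mul_of_nonneg_right (hZ i j)
      (mul_nonneg (abs_nonneg (x i)) (abs_nonneg (y j)))
    have h3 : 2 * (|x i| * |y j|) ≤ x i * x i + y j * y j := by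
      nlinarith [sq_nonneg (|x i| - |y j|), abs_mul_abs_self (x i), abs_mul_abs_self (y j)]
    nlinarith [mul_le_mul_of_nonneg_left h3 hz]
  have h2 : ∑ i, ∑ j, z / 2 * (x i * x i + y j * y j)
      = z / 2 * (Fintype.card n * (x ⬝ᵥ x) + Fintype.card m * (y ⬝ᵥ y)) := by
    simp only [← Finset.mul_sum, Finset.sum_add_distrib, Finset.sum_const, Finset.card_univ,
      nsmul_eq_mul, dotProduct]
    congr 2
    rw [Finset.mul_sum]
    exact Finset.sum_congr rfl fun i _ => by ring
  rw [h2] at h1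
  linarith

variable {κ : Type*} [Fintype κ] [DecidableEq κ] {n₁ n₂ : ℕ}

/-- The spectral norm of the deviation of a sampled matrix from its expectation. -/
theorem freq_not_spectralLe_sampleOp_sub_le (hn₁ : 0 < n₁) (hn : n₁ ≤ n₂)
    {Z : Matrix (Fin n₁) (Fin n₂) ℝ} {z c : ℝ} (hz : 0 < z) (hZ : ∀ i j, |Z i j| ≤ z)
    (hc : 0 < c) (hcz : c ≤ 3 / 4 * n₂ * z) (hκ : 0 < Fintype.card κ) :
    freq (fun w : κ → Fin n₁ × Fin n₂ =>
        ¬ SpectralLe ((n₁ * n₂ / Fintype.card κ : ℝ) • sampleOp w Z - Z) c)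
      ≤ (n₁ + n₂) * Real.exp (-(Fintype.card κ * c ^ 2 / (3 * (n₁ * n₂) * n₂ * z ^ 2))) := by
  obtain ⟨D, hD⟩ : ∃ D : ℝ, D = n₁ * n₂ := ⟨_, rfl⟩
  obtain ⟨q, hq⟩ : ∃ q : ℝ, q = Fintype.card κ := ⟨_, rfl⟩
  have hcard : (Fintype.card (Fin n₁ × Fin n₂) : ℝ) = D := by simp [hD]
  have hcard' : (Fintype.card (Fin n₂ × Fin n₁) : ℝ) = D := by simp [hD, mul_comm]
  have hn1 : (1 : ℝ) ≤ n₁ := by exact_mod_cast hn₁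
  have hn12 : (n₁ : ℝ) ≤ n₂ := by exact_mod_cast hn
  have hD1 : (n₁ : ℝ) ≤ D := by rw [hD]; nlinarith
  have hD2 : (n₂ : ℝ) ≤ D := by rw [hD]; nlinarith
  have hD0 : 0 < D := by linarith
  have hq0 : 0 < q := by rw [hq]; exact Nat.cast_pos.mpr hκ
  have hn20 : (0 : ℝ) < n₂ := by linarith
  rw [← hq, ← hD]
  let A : Fin n₁ × Fin n₂ → Matrix (Fin n₁) (Fin n₂) ℝ := fun a =>
    (D * Z a.1 a.2) • Matrix.single a.1 a.2 1 - Z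
  -- The symmetric dilation brings a rectangular matrix within reach of the symmetric Bernstein
  -- inequality; its quadratic form is `2 * (x ⬝ᵥ A y)`, the form in `SpectralLe`.
  let X : Fin n₁ × Fin n₂ → Matrix (Fin n₁ ⊕ Fin n₂) (Fin n₁ ⊕ Fin n₂) ℝ := fun a =>
    fromBlocks 0 (A a) (A a)ᵀ 0
  have hdot : ∀ u v : Fin n₁ ⊕ Fin n₂ → ℝ,
      u ⬝ᵥ v = (u ∘ Sum.inl) ⬝ᵥ (v ∘ Sum.inl) + (u ∘ Sum.inr) ⬝ᵥ (v ∘ Sum.inr) := fun u v => by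
    simp [dotProduct, Fintype.sum_sum_type]
  have hXv : ∀ a (v : Fin n₁ ⊕ Fin n₂ → ℝ),
      X a *ᵥ v = Sum.elim (A a *ᵥ (v ∘ Sum.inr)) ((A a)ᵀ *ᵥ (v ∘ Sum.inl)) := by
    intro a v
    rw [fromBlocks_mulVec]
    simp
  have hquad : ∀ a (v : Fin n₁ ⊕ Fin n₂ → ℝ),
      v ⬝ᵥ X a *ᵥ v = 2 * ((v ∘ Sum.inl) ⬝ᵥ A a *ᵥ (v ∘ Sum.inr)) := by
    intro a v
    rw [hXv, hdot, Sum.elim_comp_inl, Sum.elim_comp_inr, dotProduct_transpose_mulVec]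
    ring
  have hA : ∀ a x y, x ⬝ᵥ A a *ᵥ y = D * (Z a.1 a.2 * (x a.1 * y a.2)) - x ⬝ᵥ Z *ᵥ y := by
    intro a x y
    simp only [A, sub_mulVec, dotProduct_sub, smul_mulVec, dotProduct_smul, smul_eq_mul]
    congr 1
    rw [mul_assoc, ← frobInner_vecMulVec, frobInner_single_left, vecMulVec_apply]
  have hsumZ : ∀ x y, ∑ a : Fin n₁ × Fin n₂, Z a.1 a.2 * (x a.1 * y a.2) = x ⬝ᵥ Z *ᵥ y := by
    intro x y
    rw [← frobInner_vecMulVec, frobInner, Fintype.sum_prod_type]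
    rfl
  set s : ℝ := D * n₂ * z ^ 2 with hs
  have hs0 : 0 < s := by positivity
  -- This `θ` minimizes the exponent; the hypothesis `hcz` is exactly the condition `θ * R ≤ 1` for
  -- `R = 2 * D * z`.
  have hθ : 0 < 2 * c / (3 * s) := by positivity
  have hB := freq_exists_quadraticForm_gt_le (κ := κ) (R := 2 * D * z) (s := s)
    (θ := 2 * c / (3 * s)) (t := q * c) X (fun a => ?_) (fun v => ?_) (fun a v => ?_) (fun v => ?_)
    hs0.le hθ ?_
  · have hexp : -(2 * c / (3 * s) * (q * c)) + q * (3 / 4 * (2 * c / (3 * s)) ^ 2 * s)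
        = -(q * c ^ 2 / (3 * D * n₂ * z ^ 2)) := by
      rw [hs]; field_simp; ring
    rw [← hq, hexp, Fintype.card_sum, Fintype.card_fin, Fintype.card_fin, Nat.cast_add] at hB
    refine (freq_mono fun w hw => ?_).trans hB
    simp only [SpectralLe] at hw
    push Not at hw
    obtain ⟨x, y, hxy⟩ := hw
    refine ⟨Sum.elim x y, ?_⟩
    simp only [hquad, hdot, Sum.elim_comp_inl, Sum.elim_comp_inr, hA]
    have h1 : x ⬝ᵥ sampleOp w Z *ᵥ y
        = ∑ k, Z (w k).1 (w k).2 * (x (w k).1 * y (w k).2) := by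
      rw [sampleOp, sum_mulVec, dotProduct_sum]
      refine Finset.sum_congr rfl fun k _ => ?_
      rw [smul_mulVec, dotProduct_smul, smul_eq_mul, ← frobInner_vecMulVec, frobInner_single_left,
        vecMulVec_apply]
    rw [sub_mulVec, smul_mulVec, dotProduct_sub, dotProduct_smul, smul_eq_mul, h1] at hxy
    rw [← Finset.mul_sum, Finset.sum_sub_distrib, ← Finset.mul_sum, Finset.sum_const,
      Finset.card_univ, nsmul_eq_mul, ← hq]
    have h2 := mul_lt_mul_of_pos_left hxy hq0
    have h3 : q * (2 * (D / q * ∑ k, Z (w k).1 (w k).2 * (x (w k).1 * y (w k).2) - x ⬝ᵥ Z *ᵥ y))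
        = 2 * (D * ∑ k, Z (w k).1 (w k).2 * (x (w k).1 * y (w k).2) - q * x ⬝ᵥ Z *ᵥ y) := by
      field_simp
    rw [h3] at h2
    linarith
  · simp only [X, fromBlocks_transpose, transpose_zero, transpose_transpose]
  · simp only [hquad, hA]
    rw [← Finset.mul_sum, Finset.sum_sub_distrib, ← Finset.mul_sum, hsumZ, Finset.sum_const,
      Finset.card_univ, nsmul_eq_mul, hcard, sub_self, mul_zero]
  · rw [hquad, hA, hdot]
    set x := v ∘ Sum.inl
    set y := v ∘ Sum.inr
    have hx := dotProduct_self_nonneg' x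
    have hy := dotProduct_self_nonneg' y
    have h1 := two_mul_abs_dotProduct_mulVec_le hz.le hZ x y
    rw [Fintype.card_fin, Fintype.card_fin] at h1
    have h2 : 2 * |Z a.1 a.2 * (x a.1 * y a.2)| ≤ z * (x ⬝ᵥ x + y ⬝ᵥ y) := by
      have hxa : x a.1 * x a.1 ≤ x ⬝ᵥ x := Finset.single_le_sum (f := fun i => x i * x i)
        (fun i _ => mul_self_nonneg _) (Finset.mem_univ a.1)
      have hya : y a.2 * y a.2 ≤ y ⬝ᵥ y := Finset.single_le_sum (f := fun i => y i * y i)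
        (fun i _ => mul_self_nonneg _) (Finset.mem_univ a.2)
      rw [abs_mul, abs_mul]
      have h3 : 2 * (|x a.1| * |y a.2|) ≤ x ⬝ᵥ x + y ⬝ᵥ y := by
        nlinarith [sq_nonneg (|x a.1| - |y a.2|), abs_mul_abs_self (x a.1),
          abs_mul_abs_self (y a.2)]
      have h4 := mul_le_mul_of_nonneg_right (hZ a.1 a.2)
        (mul_nonneg (abs_nonneg (x a.1)) (abs_nonneg (y a.2)))
      nlinarith [mul_le_mul_of_nonneg_left h3 hz.le]
    have h5 : |2 * (D * (Z a.1 a.2 * (x a.1 * y a.2)) - x ⬝ᵥ Z *ᵥ y)|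
        ≤ D * (2 * |Z a.1 a.2 * (x a.1 * y a.2)|) + 2 * |x ⬝ᵥ Z *ᵥ y| := by
      rw [abs_mul, abs_two]
      have := abs_sub (D * (Z a.1 a.2 * (x a.1 * y a.2))) (x ⬝ᵥ Z *ᵥ y)
      rw [abs_mul D, abs_of_pos hD0] at this
      linarith
    have h6 := mul_le_mul_of_nonneg_left h2 hD0.le
    have h7 : z * (n₂ * (x ⬝ᵥ x) + n₁ * (y ⬝ᵥ y)) ≤ z * (D * (x ⬝ᵥ x) + D * (y ⬝ᵥ y)) :=
      mul_le_mul_of_nonneg_left (add_le_add (mul_le_mul_of_nonneg_right hD2 hx)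
        (mul_le_mul_of_nonneg_right hD1 hy)) hz.le
    linarith
  · rw [hdot v v, hcard]
    simp only [hXv, hdot (Sum.elim _ _), Sum.elim_comp_inl, Sum.elim_comp_inr]
    rw [Finset.sum_add_distrib]
    set x := v ∘ Sum.inl
    set y := v ∘ Sum.inr
    have hx := dotProduct_self_nonneg' x
    have hy := dotProduct_self_nonneg' y
    have h1 := sum_mulVec_smul_single_sub_le hZ hcard y
    have h2 := sum_mulVec_smul_single_sub_le (Z := Zᵀ) (fun i j => hZ j i) hcard' x
    have h3 : ∑ a : Fin n₁ × Fin n₂, (A a)ᵀ *ᵥ x ⬝ᵥ (A a)ᵀ *ᵥ x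
        = ∑ a : Fin n₂ × Fin n₁, ((D * Zᵀ a.1 a.2) • Matrix.single a.1 a.2 1 - Zᵀ) *ᵥ x
        ⬝ᵥ ((D * Zᵀ a.1 a.2) • Matrix.single a.1 a.2 1 - Zᵀ) *ᵥ x := by
      refine Fintype.sum_equiv (Equiv.prodComm _ _) _ _ fun a => ?_
      simp only [A, transpose_sub, transpose_smul, transpose_single, Equiv.prodComm_apply,
        Prod.fst_swap, Prod.snd_swap, transpose_apply]
    rw [h3]
    rw [Fintype.card_fin] at h1 h2
    have h4 : D ^ 2 * z ^ 2 * n₁ * (y ⬝ᵥ y) ≤ D ^ 2 * z ^ 2 * n₂ * (y ⬝ᵥ y) :=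
      mul_le_mul_of_nonneg_right (mul_le_mul_of_nonneg_left hn12 (by positivity)) hy
    rw [hs]
    linarith
  · rw [hs, div_mul_eq_mul_div, div_le_one (by positivity)]
    have := mul_le_mul_of_nonneg_left hcz (show 0 ≤ 4 * (D * z) by positivity)
    linarith

end SpectralDeviation

/-! ### Repeated samples. -/

section Repetition

/-- With high probability no element is sampled many times. -/
theorem freq_exists_count_gt_le {κ ι : Type*} [Fintype κ] [DecidableEq κ] [Fintype ι]
    [DecidableEq ι] (hκ : Fintype.card κ ≤ Fintype.card ι) (K : ℝ) :
    freq (fun w : κ → ι => ∃ a, K < ∑ k, if w k = a then (1 : ℝ) else 0)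
      ≤ Fintype.card ι * Real.exp (2 - K) := by
  refine freq_exists_le _ fun a => ?_
  have hι : (0 : ℝ) < Fintype.card ι := Nat.cast_pos.mpr (Fintype.card_pos_iff.mpr ⟨a⟩)
  rw [Real.exp_sub]
  -- A Chernoff bound with parameter one: the exponential moment factorizes over draws, each factor
  -- is at most `exp (2 / card ι)` since `e - 1 < 2`, and there are at most `card ι` draws.
  refine freq_le_of_forall_mul_le
    (f := fun w : κ → ι => Real.exp (∑ k, if w k = a then (1 : ℝ) else 0))
    (fun w => (Real.exp_pos _).le) (Real.exp_pos _) (fun w hw => Real.exp_le_exp.mpr hw.le) ?_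
    (Real.exp_pos _).le
  simp only [Real.exp_sum]
  have h1 : ∑ w : κ → ι, ∏ k, Real.exp (if w k = a then 1 else 0)
      = (∑ b : ι, Real.exp (if b = a then 1 else 0)) ^ Fintype.card κ := by
    have := Finset.prod_univ_sum (ι := κ) (fun _ => (Finset.univ : Finset ι))
      (fun _ b => Real.exp (if b = a then 1 else 0))
    rw [Fintype.piFinset_univ, Finset.prod_const, Finset.card_univ] at this
    exact this.symm
  have h2 : ∑ b : ι, Real.exp (if b = a then 1 else 0) = Fintype.card ι + (Real.exp 1 - 1) := by
    have : ∀ b : ι, Real.exp (if b = a then 1 else 0)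
        = 1 + if b = a then Real.exp 1 - 1 else 0 := fun b => by split_ifs <;> simp
    simp only [this, Finset.sum_add_distrib, Finset.sum_ite_eq', Finset.mem_univ, if_true,
      Finset.sum_const, Finset.card_univ, nsmul_eq_mul, mul_one]
  have h3 : (Fintype.card ι : ℝ) + (Real.exp 1 - 1)
      ≤ Fintype.card ι * Real.exp (2 / Fintype.card ι) := by
    have h4 := Real.add_one_le_exp (2 / (Fintype.card ι : ℝ))
    have h5 := mul_le_mul_of_nonneg_left h4 hι.le
    have h6 : (Fintype.card ι : ℝ) * (2 / Fintype.card ι + 1) = 2 + Fintype.card ι := by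
      field_simp
    have := Real.exp_one_lt_d9
    linarith
  rw [h1, h2, Fintype.card_fun, Nat.cast_pow]
  calc ((Fintype.card ι : ℝ) + (Real.exp 1 - 1)) ^ Fintype.card κ
      ≤ (Fintype.card ι * Real.exp (2 / Fintype.card ι)) ^ Fintype.card κ := by
        refine pow_le_pow_left₀ ?_ h3 _
        have := Real.one_le_exp (show (0 : ℝ) ≤ 1 by norm_num)
        linarith
    _ = Real.exp (Fintype.card κ * (2 / Fintype.card ι)) * (Fintype.card ι : ℝ) ^ Fintype.card κ := by
        rw [mul_pow, Real.exp_nat_mul, mul_comm]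
    _ ≤ Real.exp 2 * (Fintype.card ι : ℝ) ^ Fintype.card κ := by
        refine mul_le_mul_of_nonneg_right (Real.exp_le_exp.mpr ?_) (by positivity)
        rw [mul_div_assoc', div_le_iff₀ hι, mul_comm]
        have : (Fintype.card κ : ℝ) ≤ Fintype.card ι := by exact_mod_cast hκ
        linarith

end Repetition

/-! ### The golfing scheme. -/

section Golfing

theorem freq_eq_zero {α : Type*} [Fintype α] {B : α → Prop} (h : ∀ a, ¬ B a) : freq B = 0 := by
  simp [freq, h]

theorem IsOrthProj.mul_one_sub {m : Type*} [Fintype m] [DecidableEq m] {P : Matrix m m ℝ}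
    (hP : IsOrthProj P) : P * (1 - P) = 0 := by
  rw [Matrix.mul_sub, Matrix.mul_one, hP.2, sub_self]

theorem IsOrthProj.one_sub_mul {m : Type*} [Fintype m] [DecidableEq m] {P : Matrix m m ℝ}
    (hP : IsOrthProj P) : (1 - P) * P = 0 := by
  rw [Matrix.sub_mul, Matrix.one_mul, hP.2, sub_self]

variable {n₁ n₂ : ℕ} {P : Matrix (Fin n₁) (Fin n₁) ℝ} {Q : Matrix (Fin n₂) (Fin n₂) ℝ}

theorem sampleOp_apply_eq_zero {κ : Type*} [Fintype κ] {w : κ → Fin n₁ × Fin n₂}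
    {i : Fin n₁} {j : Fin n₂} (h : ∀ k, w k ≠ (i, j)) (Z : Matrix (Fin n₁) (Fin n₂) ℝ) :
    sampleOp w Z i j = 0 := by
  rw [sampleOp, Matrix.sum_apply]
  refine Finset.sum_eq_zero fun k _ => ?_
  have : ¬ ((w k).1 = i ∧ (w k).2 = j) := fun hk => h k (Prod.ext hk.1 hk.2)
  simp [this]

/-- The golfing scheme: independent batches of samples yield an approximate dual certificate. -/
theorem freq_not_exists_dualCertificate_le {q : ℕ} (hP : IsOrthProj P) (hQ : IsOrthProj Q)
    {ρ δ : ℝ} (hρ : 0 ≤ ρ)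
    (hbatch : ∀ (Z : Matrix (Fin n₁) (Fin n₂) ℝ) (z : ℝ), tanProj P Q Z = Z → 0 < z →
      (∀ i j, |Z i j| ≤ z) → freq (fun w : Fin q → Fin n₁ × Fin n₂ =>
        ¬ ((∀ i j, |(Z - (n₁ * n₂ / q : ℝ) • tanProj P Q (sampleOp w Z)) i j| ≤ z / 2) ∧
          SpectralLe ((n₁ * n₂ / q : ℝ) • sampleOp w Z - Z) (ρ * z))) ≤ δ)
    (p : ℕ) {Z : Matrix (Fin n₁) (Fin n₂) ℝ} {z : ℝ} (hZ : tanProj P Q Z = Z) (hz : 0 < z)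
    (hZz : ∀ i j, |Z i j| ≤ z) :
    freq (fun w : Fin p → Fin q → Fin n₁ × Fin n₂ => ¬ ∃ Y : Matrix (Fin n₁) (Fin n₂) ℝ,
      (∀ i j, (∀ l k, w l k ≠ (i, j)) → Y i j = 0) ∧
      (∀ i j, |(Z - tanProj P Q Y) i j| ≤ z / 2 ^ p) ∧
      SpectralLe (Y - tanProj P Q Y) (2 * (ρ * z))) ≤ p * δ := by
  induction p generalizing Z z with
  | zero =>
    have : ∀ w : Fin 0 → Fin q → Fin n₁ × Fin n₂, ∃ Y : Matrix (Fin n₁) (Fin n₂) ℝ,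
        (∀ i j, (∀ l k, w l k ≠ (i, j)) → Y i j = 0) ∧
        (∀ i j, |(Z - tanProj P Q Y) i j| ≤ z / 2 ^ 0) ∧
        SpectralLe (Y - tanProj P Q Y) (2 * (ρ * z)) := by
      refine fun w => ⟨0, fun _ _ _ => rfl, ?_, ?_⟩
      · simpa using hZz
      · intro x y
        have := dotProduct_self_nonneg' x
        have := dotProduct_self_nonneg' y
        simp only [map_zero, sub_zero, zero_mulVec, dotProduct_zero, mul_zero]
        positivity
    rw [freq_eq_zero fun w hw => hw (this w)]
    simp
  | succ p ih =>
    have hδ : 0 ≤ δ := (freq_nonneg _).trans (hbatch Z z hZ hz hZz)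
    rw [← freq_equiv (Fin.consEquiv fun _ : Fin (p + 1) => Fin q → Fin n₁ × Fin n₂)]
    let Z' : (Fin q → Fin n₁ × Fin n₂) → Matrix (Fin n₁) (Fin n₂) ℝ := fun g =>
      Z - (n₁ * n₂ / q : ℝ) • tanProj P Q (sampleOp g Z)
    have hZ' : ∀ g, tanProj P Q (Z' g) = Z' g := fun g => by
      simp only [Z', map_sub, map_smul, hZ, tanProj_tanProj hP hQ]
    let Good : (Fin q → Fin n₁ × Fin n₂) → Prop := fun g =>
      (∀ i j, |Z' g i j| ≤ z / 2) ∧ SpectralLe ((n₁ * n₂ / q : ℝ) • sampleOp g Z - Z) (ρ * z)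
    have hfirst : freq (fun g => ¬ Good g) ≤ δ := hbatch Z z hZ hz hZz
    -- With the first batch `g` frozen and good, the residual `Z' g` lies in the tangent space with
    -- entries at most `z / 2`, so the induction hypothesis applies to it.
    have hrest : freq (fun x : (Fin q → Fin n₁ × Fin n₂) × (Fin p → Fin q → Fin n₁ × Fin n₂) =>
        Good x.1 ∧ ¬ ∃ Y : Matrix (Fin n₁) (Fin n₂) ℝ,
          (∀ i j, (∀ l k, x.2 l k ≠ (i, j)) → Y i j = 0) ∧
          (∀ i j, |(Z' x.1 - tanProj P Q Y) i j| ≤ z / 2 / 2 ^ p) ∧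
          SpectralLe (Y - tanProj P Q Y) (2 * (ρ * (z / 2)))) ≤ p * δ := by
      refine freq_prod_le (by positivity) fun g => ?_
      by_cases hg : Good g
      · exact (freq_mono fun w hw => hw.2).trans (ih (hZ' g) (by positivity) hg.1)
      · rw [freq_eq_zero fun w hw => hg hw.1]
        positivity
    refine (freq_mono ?_).trans ((freq_or_le _ _).trans ((add_le_add
      ((freq_comp_fst_le (fun g => ¬ Good g)).trans hfirst) hrest).trans
      (le_of_eq (by push_cast; ring))))
    rintro ⟨g, w⟩ hbad
    by_contra hcon
    push Not at hcon
    obtain ⟨hg, hw⟩ := hcon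
    obtain ⟨Y, hY1, hY2, hY3⟩ := hw hg
    -- The first batch's rescaled sample of `Z` corrected by the certificate of the residual. Since
    -- `Z` is tangent, only the sampling error leaves the tangent space, and `ρ z + 2 ρ (z / 2) = 2
    -- ρ z`.
    refine hbad ⟨(n₁ * n₂ / q : ℝ) • sampleOp g Z + Y, fun i j hij => ?_, fun i j => ?_, ?_⟩
    · have h1 : sampleOp g Z i j = 0 := sampleOp_apply_eq_zero (fun k => hij 0 k) Z
      have h2 : Y i j = 0 := hY1 i j fun l k => hij l.succ k
      rw [Matrix.add_apply, Matrix.smul_apply, h1, h2, smul_zero, add_zero]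
    · have h1 : Z - tanProj P Q ((n₁ * n₂ / q : ℝ) • sampleOp g Z + Y)
          = Z' g - tanProj P Q Y := by
        simp only [Z', map_add, map_smul]
        abel
      rw [h1]
      refine (hY2 i j).trans (le_of_eq ?_)
      rw [pow_succ]
      field_simp
    · have h1 : (n₁ * n₂ / q : ℝ) • sampleOp g Z + Y
            - tanProj P Q ((n₁ * n₂ / q : ℝ) • sampleOp g Z + Y)
          = (1 - P) * ((n₁ * n₂ / q : ℝ) • sampleOp g Z - Z) * (1 - Q) + (Y - tanProj P Q Y) := by
        rw [← sub_tanProj, map_add, map_sub, hZ]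
        abel
      rw [h1]
      have h2 := SpectralLe.mul_mul hP.one_sub hQ.one_sub (by positivity) hg.2
      convert h2.add hY3 using 1
      ring

end Golfing

/-! ### A dual certificate implies exact recovery. -/

section Recovery

variable {n₁ n₂ r : ℕ} {M : Matrix (Fin n₁) (Fin n₂) ℝ} {U : Matrix (Fin n₁) (Fin r) ℝ}
  {σ : Fin r → ℝ} {V : Matrix (Fin n₂) (Fin r) ℝ}

theorem tanProj_mul_transpose (hU : Uᵀ * U = 1) :
    tanProj (U * Uᵀ) (V * Vᵀ) (U * Vᵀ) = U * Vᵀ := by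
  have h : U * Uᵀ * (U * Vᵀ) = U * Vᵀ := by
    rw [Matrix.mul_assoc, ← Matrix.mul_assoc Uᵀ, hU, Matrix.one_mul]
  rw [tanProj_apply, h]
  abel

/-- The two summands have orthogonal row spaces and orthogonal column spaces, so the bounds for the
projected and complementary parts of `x` and `y` add up by Pythagoras. -/
theorem spectralLe_mul_transpose_add (hU : Uᵀ * U = 1) (hV : Vᵀ * V = 1)
    {Q : Matrix (Fin n₁) (Fin n₂) ℝ} (hQ : SpectralLe Q 1) (hUQ : U * Uᵀ * Q = 0)
    (hVQ : Q * (V * Vᵀ) = 0) : SpectralLe (U * Vᵀ + Q) 1 := by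
  intro x y
  have hPU := isOrthProj_mul_transpose hU
  have hPV := isOrthProj_mul_transpose hV
  have h1 : x ⬝ᵥ (U * Vᵀ) *ᵥ y = (Uᵀ *ᵥ x) ⬝ᵥ (Vᵀ *ᵥ y) := by
    rw [← mulVec_mulVec, dotProduct_mulVec, ← mulVec_transpose]
  have h2 : 2 * ((Uᵀ *ᵥ x) ⬝ᵥ (Vᵀ *ᵥ y))
      ≤ (Uᵀ *ᵥ x) ⬝ᵥ (Uᵀ *ᵥ x) + (Vᵀ *ᵥ y) ⬝ᵥ (Vᵀ *ᵥ y) := by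
    simp only [dotProduct, Finset.mul_sum, ← Finset.sum_add_distrib]
    exact Finset.sum_le_sum fun k _ => by nlinarith [sq_nonneg ((Uᵀ *ᵥ x) k - (Vᵀ *ᵥ y) k)]
  have h3 : ∀ {n : ℕ} (W : Matrix (Fin n) (Fin r) ℝ) (x : Fin n → ℝ), Wᵀ * W = 1 →
      (Wᵀ *ᵥ x) ⬝ᵥ (Wᵀ *ᵥ x) = ((W * Wᵀ) *ᵥ x) ⬝ᵥ ((W * Wᵀ) *ᵥ x) := by
    intro n W x hW
    rw [(isOrthProj_mul_transpose hW).dotProduct_mulVec_self, ← mulVec_mulVec,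
      dotProduct_mulVec x, ← mulVec_transpose]
  have h4 : x ⬝ᵥ Q *ᵥ y
      = ((1 - U * Uᵀ) *ᵥ x) ⬝ᵥ Q *ᵥ ((1 - V * Vᵀ) *ᵥ y) := by
    rw [hPU.one_sub.dotProduct_mulVec, mulVec_mulVec, mulVec_mulVec, Matrix.sub_mul,
      Matrix.one_mul, hUQ, sub_zero, Matrix.mul_sub, Matrix.mul_one, hVQ, sub_zero]
  have h5 := hQ ((1 - U * Uᵀ) *ᵥ x) ((1 - V * Vᵀ) *ᵥ y)
  rw [h3 U x hU, h3 V y hV] at h2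
  have h6 := hPU.dotProduct_add x
  have h7 := hPV.dotProduct_add y
  rw [add_mulVec, dotProduct_add, h1, h4]
  linarith

variable {κ : Type*} [Fintype κ] {w : κ → Fin n₁ × Fin n₂} {K : ℝ}

theorem sum_sq_le_mul_frobInner
    (hcount : ∀ a, ∑ k, (if w k = a then (1 : ℝ) else 0) ≤ K) (G : Matrix (Fin n₁) (Fin n₂) ℝ) :
    ∑ k, G (w k).1 (w k).2 ^ 2 ≤ K * frobInner G G := by
  have h1 : ∀ k, G (w k).1 (w k).2 ^ 2
      = ∑ a : Fin n₁ × Fin n₂, (if w k = a then (1 : ℝ) else 0) * G a.1 a.2 ^ 2 := fun k => by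
    simp
  simp only [h1]
  rw [Finset.sum_comm, frobInner, ← Fintype.sum_prod_type' (f := fun i j => G i j * G i j),
    Finset.mul_sum]
  refine Finset.sum_le_sum fun a _ => ?_
  rw [← Finset.sum_mul, ← sq]
  exact mul_le_mul_of_nonneg_right (hcount a) (sq_nonneg _)

/-- An approximate dual certificate forces every other feasible matrix to have a larger nuclear
norm. -/
theorem IsThinSVD.nuclearNorm_lt_of_dualCertificate (h : IsThinSVD M U σ V) {q e : ℝ}
    (hq : 0 < q)
    (hlow : ∀ Z, tanProj (U * Uᵀ) (V * Vᵀ) Z = Z →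
      q / 2 * frobInner Z Z ≤ (n₁ * n₂ : ℝ) * ∑ k, Z (w k).1 (w k).2 ^ 2)
    (hcount : ∀ a, ∑ k, (if w k = a then (1 : ℝ) else 0) ≤ K)
    {Y : Matrix (Fin n₁) (Fin n₂) ℝ} (hYsupp : ∀ i j, (∀ k, w k ≠ (i, j)) → Y i j = 0)
    (hYtan : ∀ i j, |(U * Vᵀ - tanProj (U * Uᵀ) (V * Vᵀ) Y) i j| ≤ e)
    (hYnor : SpectralLe (Y - tanProj (U * Uᵀ) (V * Vᵀ) Y) (9 / 10))
    (hsmall : 2 * (n₁ * n₂ : ℝ) * K / q * ((n₁ * n₂ : ℝ) * e ^ 2) < 1 / 100)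
    {X : Matrix (Fin n₁) (Fin n₂) ℝ} (hX : ∀ k, X (w k).1 (w k).2 = M (w k).1 (w k).2)
    (hne : X ≠ M) : nuclearNorm M < nuclearNorm X := by
  have hPU := isOrthProj_mul_transpose h.orthonormal_left
  have hPV := isOrthProj_mul_transpose h.orthonormal_right
  set T := tanProj (U * Uᵀ) (V * Vᵀ) with hT
  set D : ℝ := n₁ * n₂ with hD
  have hD0 : 0 ≤ D := by positivity
  obtain ⟨H, hH⟩ : ∃ H, X = M + H := ⟨X - M, by abel⟩
  have hHw : ∀ k, H (w k).1 (w k).2 = 0 := fun k => by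
    have := hX k
    rw [hH, Matrix.add_apply] at this
    linarith
  have hH0 : H ≠ 0 := fun h0 => hne (by rw [hH, h0, add_zero])
  obtain ⟨G, hG⟩ : ∃ G, G = H - T H := ⟨_, rfl⟩
  have hTT : ∀ Z, T (T Z) = T Z := tanProj_tanProj hPU hPV
  have hTG : T G = 0 := by rw [hG, map_sub, hTT, sub_self]
  -- As `H` vanishes on the samples, `T H = -G` there. The lower bound for `T H` and the
  -- multiplicity bound for `G` are therefore comparable.
  have hGtan : frobInner (T H) (T H) ≤ 2 * D * K / q * frobInner G G := by
    have h1 := hlow (T H) (hTT H)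
    have h2 : ∀ k, T H (w k).1 (w k).2 ^ 2 = G (w k).1 (w k).2 ^ 2 := fun k => by
      rw [hG, Matrix.sub_apply, hHw]; ring
    simp only [h2] at h1
    have h3 := mul_le_mul_of_nonneg_left (sum_sq_le_mul_frobInner hcount G) hD0
    rw [div_mul_eq_mul_div, le_div_iff₀ hq]
    linarith
  have hG0 : G ≠ 0 := by
    intro h0
    rw [h0] at hGtan
    have h1 : frobInner (0 : Matrix (Fin n₁) (Fin n₂) ℝ) 0 = 0 := by simp [frobInner]
    rw [h1, mul_zero] at hGtan
    have h2 := frobInner_self_eq_zero (le_antisymm hGtan (frobInner_self_nonneg _))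
    rw [h2, sub_zero] at hG
    exact hH0 (hG.symm.trans h0)
  have hGpos : 0 < nuclearNorm G := by
    refine lt_of_le_of_ne (nuclearNorm_nonneg G) fun h0 => hG0 (frobInner_self_eq_zero ?_)
    have := frobInner_self_le_nuclearNorm_sq G
    rw [← h0] at this
    exact le_antisymm (by linarith) (frobInner_self_nonneg _)
  obtain ⟨Q, hQ1, hQG, hQl, hQr⟩ := exists_spectralLe_one_frobInner_eq G
  have hGeq : G = (1 - U * Uᵀ) * H * (1 - V * Vᵀ) := by rw [hG, hT, sub_tanProj]
  have hUQ : U * Uᵀ * Q = 0 := by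
    refine hQl _ ?_
    rw [hGeq, ← Matrix.mul_assoc, ← Matrix.mul_assoc, hPU.mul_one_sub, Matrix.zero_mul,
      Matrix.zero_mul]
  have hVQ : Q * (V * Vᵀ) = 0 := by
    refine hQr _ ?_
    rw [hGeq, Matrix.mul_assoc _ (1 - V * Vᵀ), hPV.one_sub_mul, Matrix.mul_zero]
  have hTQ : T Q = 0 := by
    rw [hT, tanProj_apply, hUQ, hVQ, Matrix.zero_mul, add_zero, sub_zero]
  have hPM : U * Uᵀ * M = M := by
    conv_lhs => rw [h.eq]
    rw [← Matrix.mul_assoc, ← Matrix.mul_assoc, Matrix.mul_assoc U, h.orthonormal_left,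
      Matrix.mul_one]
    exact h.eq.symm
  have hQM : frobInner Q M = 0 := by
    rw [← hPM, frobInner_comm, frobInner_mul_left, hPU.1, hUQ]
    simp [frobInner]
  have hHG : H = G + T H := by rw [hG]; abel
  have hQH : frobInner Q H = nuclearNorm G := by
    rw [hHG, frobInner_add_right, hQG, ← frobInner_tanProj_left hPU hPV, ← hT, hTQ]
    simp [frobInner]
  have hYH : frobInner Y H = 0 := by
    refine Finset.sum_eq_zero fun i _ => Finset.sum_eq_zero fun j _ => ?_
    by_cases hij : ∀ k, w k ≠ (i, j)
    · rw [hYsupp i j hij, zero_mul]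
    · push Not at hij
      obtain ⟨k, hk⟩ := hij
      have := hHw k
      rw [hk] at this
      rw [this, mul_zero]
  obtain ⟨W, hW⟩ : ∃ W, W = U * Vᵀ - T Y := ⟨_, rfl⟩
  have hTW : T W = W := by
    rw [hW, map_sub, hTT, hT, tanProj_mul_transpose h.orthonormal_left]
  have hWW : frobInner W W ≤ D * e ^ 2 := by
    have h1 : ∀ i j, W i j * W i j ≤ e ^ 2 := fun i j => by
      have := hYtan i j
      rw [← hW] at this
      rw [← sq]
      exact sq_le_sq' (abs_le.mp this).1 (abs_le.mp this).2
    refine (Finset.sum_le_sum fun i _ => Finset.sum_le_sum fun j _ => h1 i j).trans ?_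
    simp [hD, mul_assoc]
  have hWH : frobInner W H = frobInner W (T H) := by
    conv_lhs => rw [← hTW, frobInner_tanProj_left hPU hPV]
  have hYGH : frobInner (Y - T Y) H = frobInner (Y - T Y) G := by
    rw [hHG, frobInner_add_right, ← frobInner_tanProj_left hPU hPV, ← hT, map_sub, hTT, sub_self]
    simp [frobInner]
  have hYG : frobInner (Y - T Y) G ≤ 9 / 10 * nuclearNorm G := frobInner_le_mul_nuclearNorm hYnor G
  -- The tangential error costs strictly less than the tenth of `‖G‖_*` that `hYnor` leaves over.
  have hWTH : frobInner W (T H) ^ 2 < (nuclearNorm G / 10) ^ 2 := by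
    calc frobInner W (T H) ^ 2 ≤ frobInner W W * frobInner (T H) (T H) := frobInner_sq_le _ _
      _ ≤ D * e ^ 2 * (2 * D * K / q * frobInner G G) :=
          mul_le_mul hWW hGtan (frobInner_self_nonneg _) (by positivity)
      _ = 2 * D * K / q * (D * e ^ 2) * frobInner G G := by ring
      _ < 1 / 100 * frobInner G G := by
          refine mul_lt_mul_of_pos_right hsmall ?_
          exact lt_of_le_of_ne (frobInner_self_nonneg _)
            fun h0 => hG0 (frobInner_self_eq_zero h0.symm)
      _ ≤ 1 / 100 * nuclearNorm G ^ 2 :=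
          mul_le_mul_of_nonneg_left (frobInner_self_le_nuclearNorm_sq G) (by norm_num)
      _ = _ := by ring
  have hlb := (abs_lt_of_sq_lt_sq' hWTH (by positivity)).1
  have hUVH : frobInner (U * Vᵀ) H = frobInner W (T H) - frobInner (Y - T Y) G := by
    have : U * Vᵀ = W - (Y - T Y) + Y := by rw [hW]; abel
    rw [this, frobInner_add_left, frobInner_sub_left, hYH, hWH, hYGH, add_zero]
  have hmain := frobInner_le_mul_nuclearNorm (spectralLe_mul_transpose_add h.orthonormal_left
    h.orthonormal_right hQ1 hUQ hVQ) X
  rw [hH, frobInner_add_left, frobInner_add_right, frobInner_add_right, hQM, hQH, hUVH,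
    h.frobInner_mul_transpose, ← hH] at hmain
  have := h.nuclearNorm_le
  linarith

theorem isNuclearNormMinimizer_iff_of_forall_lt {Ω : Finset (Fin n₁ × Fin n₂)}
    (h : ∀ X ∈ feasibleSet M Ω, X ≠ M → nuclearNorm M < nuclearNorm X)
    (X : Matrix (Fin n₁) (Fin n₂) ℝ) : IsNuclearNormMinimizer M Ω X ↔ X = M := by
  have hM : M ∈ feasibleSet M Ω := fun _ _ => rfl
  constructor
  · rintro ⟨hX, hmin⟩
    by_contra hne
    exact absurd (isMinOn_iff.mp hmin M hM) (not_le.mpr (h X hX hne))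
  · rintro rfl
    refine ⟨hM, isMinOn_iff.mpr fun Y hY => ?_⟩
    by_cases hne : Y = X
    · rw [hne]
    · exact (h Y hY hne).le

/-- More constraints shrink the feasible set but keep `M` in it. This monotonicity is what permits
replacing the random `m`-set by draws with replacement. -/
theorem isNuclearNormMinimizer_iff_mono {A B : Finset (Fin n₁ × Fin n₂)} (hAB : A ⊆ B)
    (hA : ∀ X, IsNuclearNormMinimizer M A X ↔ X = M) (X : Matrix (Fin n₁) (Fin n₂) ℝ) :
    IsNuclearNormMinimizer M B X ↔ X = M := by
  refine isNuclearNormMinimizer_iff_of_forall_lt (fun Y hY hne => ?_) X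
  have hYA : Y ∈ feasibleSet M A := fun p hp => hY p (hAB hp)
  have hM := isMinOn_iff.mp ((hA M).mpr rfl).2
  by_contra hlt
  exact hne ((hA Y).mp ⟨hYA, isMinOn_iff.mpr fun Z hZ => (not_lt.mp hlt).trans (hM Z hZ)⟩)

end Recovery

/-! ### Combining the bad events; a priori bounds and batch sizes. -/

section Assembly

variable {n₁ n₂ r : ℕ} {M : Matrix (Fin n₁) (Fin n₂) ℝ} {U : Matrix (Fin n₁) (Fin r) ℝ}
  {σ : Fin r → ℝ} {V : Matrix (Fin n₂) (Fin r) ℝ}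

/-- The failure probability of nuclear norm minimization for `p` batches of `q` samples drawn with
replacement. -/
theorem IsThinSVD.freq_not_isNuclearNormMinimizer_iff_le (h : IsThinSVD M U σ V) {p q : ℕ}
    {N z ρ K : ℝ} (hn₁ : 0 < n₁) (hn : n₁ ≤ n₂) (hp : 0 < p) (hq : 0 < q) (hpq : p * q ≤ n₁ * n₂)
    (hN1 : 1 ≤ N) (hN : ∀ i j, (n₁ * n₂ : ℝ) * ((U * Uᵀ) i i + (V * Vᵀ) j j) ≤ N)
    (hz : 0 < z) (hUV : ∀ i j, |(U * Vᵀ) i j| ≤ z) (hρ : 0 < ρ) (hρn : ρ ≤ 3 / 4 * n₂)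
    (hρz : 2 * (ρ * z) ≤ 9 / 10)
    (hsmall : 2 * (n₁ * n₂ : ℝ) * K / (p * q) * ((n₁ * n₂ : ℝ) * (z / 2 ^ p) ^ 2) < 1 / 100) :
    freq (fun w : Fin p × Fin q → Fin n₁ × Fin n₂ =>
        ¬ ∀ X, IsNuclearNormMinimizer M (Finset.univ.image w) X ↔ X = M)
      ≤ p * (2 * (n₁ * n₂) * Real.exp (-(q / (12 * N)))
          + (n₁ + n₂) * Real.exp (-(q * ρ ^ 2 / (3 * (n₁ * n₂) * n₂))))
        + (n₁ * n₂ * Real.exp (-(p * q / (12 * N))) + n₁ * n₂ * Real.exp (2 - K)) := by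
  have hPU := isOrthProj_mul_transpose h.orthonormal_left
  have hPV := isOrthProj_mul_transpose h.orthonormal_right
  have hcert := freq_not_exists_dualCertificate_le (q := q)
    (δ := 2 * (n₁ * n₂) * Real.exp (-(q / (12 * N)))
      + (n₁ + n₂) * Real.exp (-(q * ρ ^ 2 / (3 * (n₁ * n₂) * n₂)))) hPU hPV hρ.le ?_ p
    (tanProj_mul_transpose (V := V) h.orthonormal_left) hz hUV
  -- The certificate sees the draws batch by batch, the other two events see all `p * q` at once;
  -- currying identifies the two sample spaces.
  · rw [← freq_equiv (Equiv.curry (Fin p) (Fin q) (Fin n₁ × Fin n₂))] at hcert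
    have hlow := freq_not_frobInner_le_sum_sq (κ := Fin p × Fin q) hPU hPV hN1 hN
    have hcount := freq_exists_count_gt_le (κ := Fin p × Fin q) (ι := Fin n₁ × Fin n₂)
      (by simpa using hpq) K
    simp only [Fintype.card_prod, Fintype.card_fin, Nat.cast_mul] at hlow hcount
    refine (freq_mono fun w hw => ?_).trans ((freq_or_le _ _).trans (add_le_add hcert
      ((freq_or_le _ _).trans (add_le_add hlow hcount))))
    by_contra hcon
    push Not at hcon
    obtain ⟨⟨Y, hY1, hY2, hY3⟩, hlow, hcount⟩ := hcon
    refine hw (isNuclearNormMinimizer_iff_of_forall_lt fun X hX hne => ?_)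
    exact h.nuclearNorm_lt_of_dualCertificate (w := w) (q := p * q) (e := z / 2 ^ p) (by positivity)
      hlow hcount (fun i j hij => hY1 i j fun l k => hij (l, k)) hY2 (hY3.mono hρz) hsmall
      (fun k => hX _ (Finset.mem_image_of_mem _ (Finset.mem_univ k))) hne
  · intro Z y hZ hy hZy
    have h1 := freq_not_abs_sub_tanProj_sampleOp_le (κ := Fin q) hPU hPV hN1 hN hZ hy hZy
      (by simpa using hq)
    have h2 := freq_not_spectralLe_sampleOp_sub_le (κ := Fin q) hn₁ hn hy hZy
      (show 0 < ρ * y by positivity) (mul_le_mul_of_nonneg_right hρn hy.le) (by simpa using hq)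
    rw [Fintype.card_fin] at h1 h2
    have hn10 : (0 : ℝ) < n₁ := by exact_mod_cast hn₁
    have hn20 : (0 : ℝ) < n₂ := by exact_mod_cast hn₁.trans_le hn
    have h3 : (q : ℝ) * (ρ * y) ^ 2 / (3 * (n₁ * n₂) * n₂ * y ^ 2)
        = q * ρ ^ 2 / (3 * (n₁ * n₂) * n₂) := by
      field_simp
    rw [h3] at h2
    refine (freq_mono fun w hw => ?_).trans ((freq_or_le _ _).trans (add_le_add h1 h2))
    exact not_and_or.mp hw

/-- The hypothesis reads `128 * L ^ 2 ≤ exp L`. Starting from `L ≥ log 2`, each lower bound on `L`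
yields a better one: `0.69`, `4`, `7`, `8`, `9`. -/
theorem nine_le_log_two_mul {x : ℝ} (hx : 1 ≤ x) (h : 64 * Real.log (2 * x) ^ 2 ≤ x) :
    9 ≤ Real.log (2 * x) := by
  set L := Real.log (2 * x) with hL
  have hexp : Real.exp L = 2 * x := Real.exp_log (by linarith)
  have h1 : 128 * L ^ 2 ≤ Real.exp L := by rw [hexp]; linarith
  have hL0 : 0.69 ≤ L := by
    have h2 : Real.log 2 ≤ L := Real.log_le_log (by norm_num) (by linarith)
    have := Real.log_two_gt_d9
    linarith
  have hpow : ∀ n : ℕ, Real.exp n ≤ 2.7182818286 ^ n := fun n => by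
    rw [← Real.exp_one_pow]
    exact pow_le_pow_left₀ (Real.exp_pos _).le Real.exp_one_lt_d9.le n
  have step : ∀ (a : ℝ) (n : ℕ), a ≤ L → 0 ≤ a → (2.7182818286 : ℝ) ^ n < 128 * a ^ 2 → n < L := by
    intro a n ha ha0 hn
    by_contra hc
    have h2 := Real.exp_le_exp.mpr (not_lt.mp hc)
    have h3 := hpow n
    have h4 : a ^ 2 ≤ L ^ 2 := pow_le_pow_left₀ ha0 ha 2
    linarith
  have h4 := step 0.69 4 hL0 (by norm_num) (by norm_num)
  have h7 := step 4 7 (by exact_mod_cast h4.le) (by norm_num) (by norm_num)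
  have h8 := step 7 8 (by exact_mod_cast h7.le) (by norm_num) (by norm_num)
  have h9 := step 8 9 (by exact_mod_cast h8.le) (by norm_num) (by norm_num)
  exact_mod_cast h9.le

/-- The diagonal entries of `U * Uᵀ` sum to `r`, while each is at most `μ * r / n₁`. -/
theorem IsThinSVD.one_le_of_coherence_le (h : IsThinSVD M U σ V) (hr : 0 < r) (hrank : M.rank = r)
    {μ : ℝ} (hμ : coherence (colSpace M) ≤ μ) : 1 ≤ μ := by
  have h1 : (U * Uᵀ).trace = r := by
    rw [trace_mul_comm, h.orthonormal_left, trace_one, Fintype.card_fin]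
  have hn : 0 < n₁ := hr.trans_le (hrank ▸ rank_le_height M)
  have h2 : (U * Uᵀ).trace ≤ ∑ _i : Fin n₁, μ * r / n₁ :=
    Finset.sum_le_sum fun i _ => h.diag_left_le hr hrank hμ i
  rw [h1, Finset.sum_const, Finset.card_univ, Fintype.card_fin, nsmul_eq_mul] at h2
  have hr0 : (0 : ℝ) < r := by exact_mod_cast hr
  have hn0 : (0 : ℝ) < n₁ := by exact_mod_cast hn
  have h3 : (n₁ : ℝ) * (μ * r / n₁) = μ * r := by field_simp
  rw [h3] at h2
  exact le_of_mul_le_mul_right (by linarith) hr0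

/-- The squared Frobenius norm of `U * Vᵀ` equals `r`. -/
theorem IsThinSVD.one_le_sq_of_abs_le (h : IsThinSVD M U σ V) (hr : 0 < r) {μ : ℝ}
    (hμ : ∀ i j, |(U * Vᵀ) i j| ≤ μ * √((r : ℝ) / ((n₁ : ℝ) * (n₂ : ℝ)))) (hn₁ : 0 < n₁)
    (hn₂ : 0 < n₂) : 1 ≤ μ ^ 2 := by
  have hr0 : (0 : ℝ) < r := by exact_mod_cast hr
  have hn10 : (0 : ℝ) < n₁ := by exact_mod_cast hn₁
  have hn20 : (0 : ℝ) < n₂ := by exact_mod_cast hn₂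
  have h1 : frobInner (U * Vᵀ) (U * Vᵀ) = r := by
    rw [frobInner_eq_trace, transpose_mul, transpose_transpose, Matrix.mul_assoc,
      ← Matrix.mul_assoc Uᵀ, h.orthonormal_left, Matrix.one_mul, trace_mul_comm,
      h.orthonormal_right, trace_one, Fintype.card_fin]
  have h2 : frobInner (U * Vᵀ) (U * Vᵀ)
      ≤ ∑ _i : Fin n₁, ∑ _j : Fin n₂, μ ^ 2 * ((r : ℝ) / ((n₁ : ℝ) * (n₂ : ℝ))) := by
    refine Finset.sum_le_sum fun i _ => Finset.sum_le_sum fun j _ => ?_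
    have h3 := pow_le_pow_left₀ (abs_nonneg _) (hμ i j) 2
    rw [sq_abs, mul_pow, Real.sq_sqrt (by positivity), sq] at h3
    exact h3
  rw [h1] at h2
  simp only [Finset.sum_const, Finset.card_univ, Fintype.card_fin, nsmul_eq_mul] at h2
  have h3 : (n₁ : ℝ) * (n₂ * (μ ^ 2 * (r / (n₁ * n₂)))) = μ ^ 2 * r := by field_simp
  rw [h3] at h2
  exact le_of_mul_le_mul_right (by linarith) hr0

/-- A partition of `m` samples into batches. -/
theorem exists_batches {m : ℕ} {B L : ℝ} (hL : 9 ≤ L) (hB : 1 ≤ B) (hm : B * L ^ 2 ≤ m) :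
    ∃ p q : ℕ, p * q ≤ m ∧ 3 / 4 * L ≤ p ∧ (p : ℝ) + 1 ≤ L ∧ B * L ≤ q := by
  -- The slack between `3 L / 4` and `L` pays for both roundings: `p ≤ L - 1`, and a quotient below
  -- `B L` would give `m < B L ^ 2`.
  refine ⟨⌈3 / 4 * L⌉₊, m / ⌈3 / 4 * L⌉₊, Nat.mul_div_le _ _, Nat.le_ceil _, ?_, ?_⟩
  · have := Nat.ceil_lt_add_one (show 0 ≤ 3 / 4 * L by linarith)
    linarith
  · set p := ⌈3 / 4 * L⌉₊ with hp
    have hp1 : 3 / 4 * L ≤ p := Nat.le_ceil _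
    have hp2 : (p : ℝ) + 1 ≤ L := by
      have := Nat.ceil_lt_add_one (show 0 ≤ 3 / 4 * L by linarith)
      linarith
    have hp0 : 0 < p := by
      have : (0 : ℝ) < p := by linarith
      exact_mod_cast this
    have h1 : m < p * (m / p + 1) := Nat.lt_mul_div_succ m hp0
    have h2 : (m : ℝ) < p * ((m / p : ℕ) + 1) := by exact_mod_cast h1
    by_contra hc
    have hc' := not_le.mp hc
    have h3 : (p : ℝ) * (m / p : ℕ) ≤ p * (B * L) :=
      mul_le_mul_of_nonneg_left hc'.le (by linarith)
    have h4 : (p : ℝ) * (B * L) ≤ (L - 1) * (B * L) :=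
      mul_le_mul_of_nonneg_right (by linarith) (by nlinarith)
    nlinarith

end Assembly

/-! ### Numerical estimates. -/

section Numerics

/-- The failure probabilities of the batches, in terms of the dimensions `x ≤ y`. -/
theorem failure_bound {x y p β e₁ e₂ e₃ : ℝ} (hx : 1 ≤ x) (hxy : x ≤ y)
    (hL : 9 ≤ Real.log (2 * y)) (hp : 0 ≤ p) (hpL : p + 1 ≤ Real.log (2 * y)) (hβ : 1 < β)
    (h₁ : 2 * β * Real.log (2 * y) ≤ e₁) (h₂ : 2 * β * Real.log (2 * y) ≤ e₂)
    (h₃ : 2 * β * Real.log (2 * y) ≤ e₃) :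
    p * (2 * (x * y) * Real.exp (-e₁) + (x + y) * Real.exp (-e₂))
        + (x * y * Real.exp (-e₃)
          + x * y * Real.exp (2 - (2 + 2 * √β * Real.log y)))
      ≤ 6 * Real.log y * (x + y) ^ (2 - 2 * β) + y ^ (2 - 2 * β ^ (1 / 2 : ℝ)) := by
  have hy : 0 < y := by linarith
  have hs : 0 < x + y := by linarith
  set L := Real.log (2 * y) with hLdef
  set ε := (x + y) ^ (-(2 * β)) with hε
  have hε0 : 0 ≤ ε := by positivity
  -- Since `x + y ≤ 2 y`, every exponent of at least `2 β L` gives a probability of at most `(x + y)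
  -- ^ (-2 β)`.
  have hexp : ∀ e, 2 * β * L ≤ e → Real.exp (-e) ≤ ε := by
    intro e he
    rw [hε, Real.rpow_def_of_pos hs]
    refine Real.exp_le_exp.mpr ?_
    have : Real.log (x + y) ≤ L := Real.log_le_log hs (by linarith)
    nlinarith
  have hpow : (x + y) ^ (2 - 2 * β) = (x + y) ^ 2 * ε := by
    rw [hε, sub_eq_add_neg, Real.rpow_add hs, Real.rpow_two]
  have hLy : L = Real.log 2 + Real.log y := Real.log_mul (by norm_num) hy.ne'
  have hlog2 := Real.log_two_lt_d9
  have hmain : p * (2 * (x * y) * Real.exp (-e₁) + (x + y) * Real.exp (-e₂))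
      + x * y * Real.exp (-e₃) ≤ 6 * Real.log y * ((x + y) ^ 2 * ε) := by
    have hy0 : 0 ≤ x * y := by positivity
    have hxy2 : 2 * (x * y) ≤ (x + y) ^ 2 / 2 := by nlinarith [sq_nonneg (x - y)]
    have hs2 : x + y ≤ (x + y) ^ 2 / 2 := by nlinarith
    calc p * (2 * (x * y) * Real.exp (-e₁) + (x + y) * Real.exp (-e₂))
          + x * y * Real.exp (-e₃)
        ≤ p * (2 * (x * y) * ε + (x + y) * ε) + x * y * ε := by
          gcongr <;> exact hexp _ ‹_›
      _ ≤ p * ((x + y) ^ 2 / 2 * ε + (x + y) ^ 2 / 2 * ε) + (x + y) ^ 2 * ε := by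
          gcongr
          nlinarith
      _ = (p + 1) * ((x + y) ^ 2 * ε) := by ring
      _ ≤ 6 * Real.log y * ((x + y) ^ 2 * ε) := by
          gcongr
          linarith
  -- The multiplicity threshold `2 + 2 √β log y` is chosen so that this exponential is `y ^ (-2
  -- √β)`; then `x y ≤ y ^ 2`.
  have hlast : x * y * Real.exp (2 - (2 + 2 * √β * Real.log y))
      ≤ y ^ (2 - 2 * β ^ (1 / 2 : ℝ)) := by
    rw [← Real.sqrt_eq_rpow, sub_eq_add_neg 2 (2 * √β), Real.rpow_add hy, Real.rpow_two,
      Real.rpow_def_of_pos hy]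
    have : 2 - (2 + 2 * √β * Real.log y) = Real.log y * -(2 * √β) := by ring
    rw [this]
    gcongr
    nlinarith
  rw [hpow]
  linarith

/-- The remainder of the golfing scheme is negligible after `p` steps. -/
theorem golfing_remainder_lt {x y r μ β p q : ℝ} {k : ℕ} (hk : (k : ℝ) = p) (hx : 1 ≤ x)
    (hxy : x ≤ y) (hr : 1 ≤ r) (hμ : 0 < μ) (hβ : 1 < β) (hL : 9 ≤ Real.log (2 * y))
    (hp : 3 / 4 * Real.log (2 * y) ≤ p)
    (hq : 32 * μ ^ 2 * r * (x + y) * β * Real.log (2 * y) ≤ q) :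
    2 * (x * y) * (2 + 2 * √β * Real.log y) / (p * q)
      * (x * y * (μ * √(r / (x * y)) / 2 ^ k) ^ 2) < 1 / 100 := by
  have hy : 0 < y := by linarith
  have hs : 0 < x + y := by linarith
  set L := Real.log (2 * y) with hLdef
  have hLy : L = Real.log 2 + Real.log y := Real.log_mul (by norm_num) hy.ne'
  have hlog2 := Real.log_two_gt_d9
  -- This is where `p ≥ 3/4 * L` is needed: `3/4 * log 4 > 1`.
  have hfour : 2 * y ≤ (4 : ℝ) ^ k := by
    rw [← Real.exp_log (show 0 < 2 * y by linarith), ← hLdef, ← Real.rpow_natCast,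
      Real.rpow_def_of_pos (by norm_num), hk]
    refine Real.exp_le_exp.mpr ?_
    rw [show (4 : ℝ) = 2 ^ 2 by norm_num, Real.log_pow]
    push_cast
    nlinarith
  have hlogy : 0 ≤ Real.log y := Real.log_nonneg (by linarith)
  have hK : 2 + 2 * √β * Real.log y ≤ 3 * β * L := by
    have h1 : √β ≤ β := Real.sqrt_le_left (by linarith) |>.mpr (by nlinarith)
    have h2 : √β * Real.log y ≤ β * L :=
      mul_le_mul h1 (by linarith) hlogy (by linarith)
    nlinarith
  have hsq : x * y * (μ * √(r / (x * y)) / 2 ^ k) ^ 2 = μ ^ 2 * r / 4 ^ k := by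
    rw [div_pow, mul_pow, Real.sq_sqrt (by positivity), ← pow_mul, mul_comm k 2, pow_mul]
    norm_num
    field_simp
  have hp0 : 0 < p := by linarith
  have hq0 : 0 < q := lt_of_lt_of_le (by positivity) hq
  rw [hsq, div_mul_div_comm, div_lt_div_iff₀ (by positivity) (by norm_num), one_mul]
  have hA : 0 < μ ^ 2 * r * β := by positivity
  calc 2 * (x * y) * (2 + 2 * √β * Real.log y) * (μ ^ 2 * r) * 100
      ≤ 2 * (((x + y) / 2) * y) * (3 * β * L) * (μ ^ 2 * r) * 100 := by
        gcongr
        linarith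
    _ = 300 * L * ((x + y) * y * (μ ^ 2 * r * β)) := by ring
    _ < 48 * L ^ 2 * ((x + y) * y * (μ ^ 2 * r * β)) := by
        refine mul_lt_mul_of_pos_right (by nlinarith) (by positivity)
    _ = 3 / 4 * L * (32 * μ ^ 2 * r * (x + y) * β * L) * (2 * y) := by ring
    _ ≤ p * q * 4 ^ k := by gcongr

end Numerics

/-! ### The zero matrix, and the failure bound for draws with replacement. -/

section Recovery

variable {n₁ n₂ r : ℕ} {M : Matrix (Fin n₁) (Fin n₂) ℝ} {U : Matrix (Fin n₁) (Fin r) ℝ}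
  {σ : Fin r → ℝ} {V : Matrix (Fin n₂) (Fin r) ℝ}

theorem nuclearNorm_pos {X : Matrix (Fin n₁) (Fin n₂) ℝ} (hX : X ≠ 0) : 0 < nuclearNorm X := by
  refine lt_of_le_of_ne (nuclearNorm_nonneg X) fun h => hX ?_
  refine frobInner_self_eq_zero (le_antisymm ?_ (frobInner_self_nonneg X))
  simpa [← h] using frobInner_self_le_nuclearNorm_sq X

theorem isNuclearNormMinimizer_zero_iff (Ω : Finset (Fin n₁ × Fin n₂))
    (X : Matrix (Fin n₁) (Fin n₂) ℝ) :
    IsNuclearNormMinimizer (0 : Matrix (Fin n₁) (Fin n₂) ℝ) Ω X ↔ X = 0 := by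
  refine isNuclearNormMinimizer_iff_of_forall_lt (fun X _ hX => ?_) X
  have : nuclearNorm (0 : Matrix (Fin n₁) (Fin n₂) ℝ) = 0 := by simp [nuclearNorm]
  rw [this]
  exact nuclearNorm_pos hX

theorem IsThinSVD.freq_not_recovery_le (h : IsThinSVD M U σ V) (hr : 0 < r) (hrank : M.rank = r)
    (hn : n₁ ≤ n₂) {μ₀ μ₁ β : ℝ} (hμ₁ : 0 < μ₁) (hβ : 1 < β)
    (hcol : coherence (colSpace M) ≤ μ₀) (hrow : coherence (rowSpace M) ≤ μ₀)
    (hUV : ∀ i j, |(U * Vᵀ) i j| ≤ μ₁ * √((r : ℝ) / ((n₁ : ℝ) * (n₂ : ℝ))))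
    {p q : ℕ} (hpq : p * q ≤ n₁ * n₂) (hL : 9 ≤ Real.log (2 * (n₂ : ℝ)))
    (hp : 3 / 4 * Real.log (2 * (n₂ : ℝ)) ≤ p) (hpL : (p : ℝ) + 1 ≤ Real.log (2 * (n₂ : ℝ)))
    (hq : 32 * max (μ₁ ^ 2) μ₀ * (r : ℝ) * ((n₁ : ℝ) + (n₂ : ℝ)) * β
      * Real.log (2 * (n₂ : ℝ)) ≤ q) :
    freq (fun w : Fin p × Fin q → Fin n₁ × Fin n₂ =>
        ¬ ∀ X, IsNuclearNormMinimizer M (Finset.univ.image w) X ↔ X = M)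
      ≤ 6 * Real.log (n₂ : ℝ) * ((n₁ : ℝ) + (n₂ : ℝ)) ^ (2 - 2 * β)
        + (n₂ : ℝ) ^ (2 - 2 * β ^ (1 / 2 : ℝ)) := by
  have hn₁ : 0 < n₁ := hr.trans_le (hrank ▸ rank_le_height M)
  have hn₂ : 0 < n₂ := hn₁.trans_le hn
  have hμ₀ : 1 ≤ μ₀ := h.one_le_of_coherence_le hr hrank hcol
  have hμ₁sq : 1 ≤ μ₁ ^ 2 := h.one_le_sq_of_abs_le hr hUV hn₁ hn₂
  have hμ₁one : 1 ≤ μ₁ := by nlinarith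
  have hx : (1 : ℝ) ≤ n₁ := by exact_mod_cast hn₁
  have hxy : (n₁ : ℝ) ≤ n₂ := by exact_mod_cast hn
  have hy : (0 : ℝ) < n₂ := by linarith
  have hR : (1 : ℝ) ≤ r := by exact_mod_cast hr
  have hN : ∀ i j, (n₁ * n₂ : ℝ) * ((U * Uᵀ) i i + (V * Vᵀ) j j)
      ≤ μ₀ * r * ((n₁ : ℝ) + n₂) := by
    intro i j
    calc (n₁ * n₂ : ℝ) * ((U * Uᵀ) i i + (V * Vᵀ) j j)
        ≤ (n₁ * n₂ : ℝ) * (μ₀ * r / n₁ + μ₀ * r / n₂) := by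
          gcongr
          · exact h.diag_left_le hr hrank hcol i
          · exact h.diag_right_le hr hrank hrow j
      _ = μ₀ * r * ((n₁ : ℝ) + n₂) := by field_simp; ring
  set L := Real.log (2 * (n₂ : ℝ)) with hLdef
  set s := (n₁ : ℝ) + n₂ with hs
  have hs0 : 0 < s := by positivity
  have hq₀ : 32 * μ₀ * r * s * β * L ≤ q := le_trans (by gcongr; exact le_max_right _ _) hq
  have hq₁ : 32 * μ₁ ^ 2 * r * s * β * L ≤ q := le_trans (by gcongr; exact le_max_left _ _) hq
  have hp1 : (1 : ℝ) ≤ p := by linarith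
  have hp0 : 0 < p := by exact_mod_cast hp1
  have hq0' : (0 : ℝ) < q := lt_of_lt_of_le (by positivity) hq₀
  have hq0 : 0 < q := by exact_mod_cast hq0'
  have hN1 : 1 ≤ μ₀ * r * s := by
    have : 1 ≤ μ₀ * r := by nlinarith
    nlinarith
  set w := √((r : ℝ) / ((n₁ : ℝ) * (n₂ : ℝ))) with hw
  have hwsq : w ^ 2 = r / ((n₁ : ℝ) * n₂) := Real.sq_sqrt (by positivity)
  have hw0 : 0 < w := Real.sqrt_pos.mpr (by positivity)
  -- Chosen so that the total spectral error `2 * ρ * (μ₁ * w)` of the golfing scheme is exactly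
  -- `9/10`.
  set ρ := 9 / 20 / (μ₁ * w) with hρ
  have hρ0 : 0 < ρ := by positivity
  have hρz : 2 * (ρ * (μ₁ * w)) ≤ 9 / 10 := by
    rw [hρ, div_mul_cancel₀ _ (by positivity)]; norm_num
  have hρsq : ρ ^ 2 = 81 / 400 * (n₁ * n₂) / (μ₁ ^ 2 * r) := by
    rw [hρ, div_pow, mul_pow, hwsq]; field_simp; norm_num
  have hρn : ρ ≤ 3 / 4 * n₂ := by
    have h1 : 1 ≤ μ₁ ^ 2 * r := by nlinarith
    refine (sq_le_sq₀ hρ0.le (by positivity)).mp ?_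
    rw [hρsq]
    refine (div_le_self (by positivity) h1).trans ?_
    nlinarith
  have hK := golfing_remainder_lt (k := p) rfl hx hxy hR hμ₁ hβ hL hp hq₁
  refine (h.freq_not_isNuclearNormMinimizer_iff_le hn₁ hn hp0 hq0 hpq hN1 hN (by positivity)
    hUV hρ0 hρn hρz hK).trans ?_
  have he₁ : 2 * β * L ≤ q / (12 * (μ₀ * r * s)) := by
    rw [le_div_iff₀ (by positivity)]
    have : 0 ≤ μ₀ * r * s * β * L := by positivity
    linarith
  refine failure_bound hx hxy hL (by linarith) hpL hβ he₁ ?_ (he₁.trans ?_)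
  -- The constant 32 suffices because `32 * (81/400) / 3 = 2.16 ≥ 2`.
  · rw [hρsq, le_div_iff₀ (by positivity), mul_div_assoc', le_div_iff₀ (by positivity)]
    have h1 : 32 * μ₁ ^ 2 * r * n₂ * β * L ≤ q := le_trans (by gcongr; linarith) hq₁
    have h2 := mul_le_mul_of_nonneg_right h1 (show 0 ≤ 81 / 400 * ((n₁ : ℝ) * n₂) by positivity)
    refine le_trans ?_ h2
    have : 0 ≤ μ₁ ^ 2 * r * n₂ * β * L * (n₁ * n₂) := by positivity
    linarith
  · gcongr
    exact le_mul_of_one_le_left hq0'.le hp1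

end Recovery

end

theorem theorem1 {n₁ n₂ r : ℕ} (hn : n₁ ≤ n₂)
    (M : Matrix (Fin n₁) (Fin n₂) ℝ) (hrank : M.rank = r)
    (U : Matrix (Fin n₁) (Fin r) ℝ) (σ : Fin r → ℝ) (V : Matrix (Fin n₂) (Fin r) ℝ)
    (hSVD : IsThinSVD M U σ V)
    (μ₀ μ₁ : ℝ) (hμ₀ : 0 < μ₀) (hμ₁ : 0 < μ₁)
    (hcol : coherence (colSpace M) ≤ μ₀) (hrow : coherence (rowSpace M) ≤ μ₀)
    (hUV : ∀ i j, |(U * Vᵀ) i j| ≤ μ₁ * √((r : ℝ) / ((n₁ : ℝ) * (n₂ : ℝ))))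
    {S : Type*} [MeasurableSpace S] (P : Measure S) [IsProbabilityMeasure P]
    (m : ℕ) (Ω : S → Finset (Fin n₁ × Fin n₂)) (hΩ : IsUniformSample P Ω m)
    (β : ℝ) (hβ : 1 < β)
    (hm : 32 * max (μ₁ ^ 2) μ₀ * (r : ℝ) * ((n₁ : ℝ) + (n₂ : ℝ)) * β
        * Real.log (2 * (n₂ : ℝ)) ^ 2 ≤ (m : ℝ)) :
    1 - 6 * Real.log (n₂ : ℝ) * ((n₁ : ℝ) + (n₂ : ℝ)) ^ (2 - 2 * β)
        - (n₂ : ℝ) ^ (2 - 2 * β ^ (1 / 2 : ℝ))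
      ≤ P.real {s | ∀ X : Matrix (Fin n₁) (Fin n₂) ℝ,
          IsNuclearNormMinimizer M (Ω s) X ↔ X = M} := by
  -- In rank zero the sample-size hypothesis is empty, but `0` is the unique minimizer for every
  -- `Ω`.
  rcases Nat.eq_zero_or_pos r with rfl | hr
  · obtain rfl : M = 0 := by rw [hSVD.eq]; ext; simp [mul_apply]
    simp only [isNuclearNormMinimizer_zero_iff, implies_true, Set.ofPred_true, probReal_univ]
    have h1 : 0 ≤ 6 * Real.log (n₂ : ℝ) * ((n₁ : ℝ) + (n₂ : ℝ)) ^ (2 - 2 * β) :=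
      mul_nonneg (mul_nonneg (by norm_num) (Real.log_natCast_nonneg _))
        (Real.rpow_nonneg (by positivity) _)
    have h2 : 0 ≤ (n₂ : ℝ) ^ (2 - 2 * β ^ (1 / 2 : ℝ)) := Real.rpow_nonneg (by positivity) _
    linarith
  have hn₁ : 0 < n₁ := hr.trans_le (hrank ▸ rank_le_height M)
  have hn₂ : 0 < n₂ := hn₁.trans_le hn
  have hx : (1 : ℝ) ≤ n₁ := by exact_mod_cast hn₁
  have hxy : (n₁ : ℝ) ≤ n₂ := by exact_mod_cast hn
  have hcard : m ≤ n₁ * n₂ := by simpa using hΩ.le_card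
  set B := 32 * max (μ₁ ^ 2) μ₀ * (r : ℝ) * ((n₁ : ℝ) + (n₂ : ℝ)) * β with hB
  have hB32 : 32 * ((n₁ : ℝ) + n₂) ≤ B := by
    have h1 : 1 ≤ max (μ₁ ^ 2) μ₀ :=
      (hSVD.one_le_of_coherence_le hr hrank hcol).trans (le_max_right _ _)
    have h2 : (1 : ℝ) ≤ r := by exact_mod_cast hr
    have h3 : 1 ≤ max (μ₁ ^ 2) μ₀ * r * β := by
      have : 1 ≤ max (μ₁ ^ 2) μ₀ * r := by nlinarith
      nlinarith
    rw [show B = max (μ₁ ^ 2) μ₀ * r * β * (32 * ((n₁ : ℝ) + n₂)) by rw [hB]; ring]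
    exact le_mul_of_one_le_left (by positivity) h3
  -- As `m ≤ n₁ n₂`, the sample-size hypothesis forces `64 log²(2 n₂) ≤ n₂`, so `n₂` is large.
  have hL : 9 ≤ Real.log (2 * (n₂ : ℝ)) := by
    refine nine_le_log_two_mul (hx.trans hxy) ?_
    have h1 : (m : ℝ) ≤ n₁ * n₂ := by exact_mod_cast hcard
    have h2 := mul_le_mul_of_nonneg_right hB32 (sq_nonneg (Real.log (2 * (n₂ : ℝ))))
    have h3 : 32 * ((n₁ : ℝ) + n₂) * Real.log (2 * (n₂ : ℝ)) ^ 2 ≤ n₁ * n₂ := by linarith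
    have h4 : (n₁ : ℝ) * n₂ ≤ ((n₁ : ℝ) + n₂) * (n₂ / 2) := by nlinarith
    have h5 : ((n₁ : ℝ) + n₂) * (32 * Real.log (2 * (n₂ : ℝ)) ^ 2)
        ≤ ((n₁ : ℝ) + n₂) * (n₂ / 2) := by linarith
    have := le_of_mul_le_mul_left h5 (by linarith)
    linarith
  obtain ⟨p, q, hpq, hp, hpL, hq⟩ := exists_batches hL (by linarith) hm
  have h1 := hSVD.freq_not_recovery_le hr hrank hn hμ₁ hβ hcol hrow hUV (hpq.trans hcard) hL hp
    hpL hq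
  have h2 := hΩ.one_sub_freq_le (κ := Fin p × Fin q) (by simpa using hpq)
    (Good := fun A => ∀ X, IsNuclearNormMinimizer M A X ↔ X = M)
    fun A B hAB hA => isNuclearNormMinimizer_iff_mono hAB hA
  linarith
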